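/- Fix $d$. Let $\mathcal M^d=\bigsqcup_{n\ge 1}M_n(\mathbb C)^d$, and for $D\subseteq\mathcal M^d$ put $D_n=D\cap M_n(\mathbb C)^d$. A *free set* is a set $D\subseteq \mathcal M^d$ that is closed under direct sums $X\oplus Y$ and under unitary conjugation $X\mapsto U^*XU$ (entrywise on tuples); it is open (connected, simply connected) if each nonempty $D_n$ is. A *free function* $g:D\to\mathcal M^d$ preserves size and satisfies $g(X\oplus Y)=g(X)\oplus g(Y)$, $g(U^*XU)=U^*g(X)U$. A function $f:D\to\mathbb C$ with $f(U^*XU)=f(X)$ is *determinantal* if $f(X\oplus Y)=f(X)f(Y)$ and *tracial* if $f(X\oplus Y)=f(X)+f(Y)$. For a differentiable tracial $f$, $\nabla f$ is the free function with $Df(X)[H]=\operatorname{tr}\sum_iH_i(\nabla f(X))_i$; for a $C^1$ determinantal $f$ without zeros, $\operatorname{div}f=\nabla\log f$, i.e. $f(X)^{-1}Df(X)[H]=\operatorname{tr}\sum_iH_i(\operatorname{div}f(X))_i$. An analytic free function $g$ is *closed* if $\operatorname{tr}\sum_i K_i(Dg(X)[H])_i=\operatorname{tr}\sum_i H_i(Dg(X)[K])_i$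 for all $X\in D$ and all $H,K$, and *exact* if $g=\nabla f$ for a tracial $f$ on $D$; $H^1_{\mathrm{tr}}(D)$ is the space of closed modulo exact free functions. Let $D$ be a connected open free set with every $D_n$ ($n\ge1$) nonempty, let $B\subseteq D$ be an anchor, that is, an open simply connected free subset, with every $B_n$ nonempty, and let $X\in B_1$ be the base point. A *global germ* is a tracial function on $B$ that continues analytically along every path in $D$ starting in $B$. A path in $D$ *essentially takes* $Y$ to $Z$ ($Y,Z\in D$) if it goes from $Y^{\oplus k}$ to $Z^{\oplus l}$ for some $k,l\ge1$. For a path $\gamma$ essentially taking $X$ to $Y$, ending at $Y^{\oplus l}$, and a global germ $f$, let $f(\gamma)$ be $\frac1l$ times the value at the end of $\gamma$ of the continuation of $f$ along $\gamma$. If $\gamma_1$ goes from $Y^{\oplus k_1}$ to $Z^{\oplus l_1}$ and $\gamma_2$ from $Z^{\oplus k_2}$ to $W^{\oplus l_2}$, then the product $\gamma_2\gamma_1$ is $\gamma_1^{\oplus k_2}$ followed by $\gamma_2^{\oplus l_1}$. Two paths $\gamma_1,\gamma_2$ essentially taking $X$ to $Y$ are *trace equivalent* if $f(\gamma_3\gamma_1)=f(\gamma_3\gamma_2)$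 for every global germ $f$ and every path $\gamma_3$ essentially taking $Y$ to a point of $D$. Let $\pi_1^{\mathrm{tr}}(D)$ be the (abelian) group of trace equivalence classes of paths essentially taking $X$ to $X$, let $\pi_1^{\mathrm{tr}}(D)_n$ consist of the classes of such paths inside $D_n$, and let $\pi_1^{\mathrm{tr}}(D)_{\mathbb Z}=\sum_{n\ge1} n\,\pi_1^{\mathrm{tr}}(D)_n$. For a class $c\in H^1_{\mathrm{tr}}(D)$ let $\phi_c(\gamma)=f(\gamma)-f(\gamma^X)$, where $\gamma^X$ is the trivial path and $f$ is a global germ with $\nabla f=h|_B$ for a closed $h$ of class $c$. Finally $H^1_{\mathrm{tr}}(D)_{\mathbb Z}$ is the set of $c\in H^1_{\mathrm{tr}}(D)$ with $\phi_c(\gamma)\in\mathbb Z$ for all $\gamma\in\pi_1^{\mathrm{tr}}(D)_{\mathbb Z}$. **Theorem.** Let $g:D\to\mathcal M^d$ be an analytic free function. There is a $C^1$ determinantal free function $f:D\to\mathbb C$ with no zeros in $D$ and $\operatorname{div}f=g$ if and only if $\frac1{2\pi i}g$ is closed and its class in $H^1_{\mathrm{tr}}(D)$ lies in $H^1_{\mathrm{tr}}(D)_{\mathbb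 Z}$. -/

import Mathlib

open Filter Topology

-- Sup norms on matrix spaces; all norms there are equivalent, and the topology is the usual one.
attribute [local instance] Matrix.normedAddCommGroup Matrix.normedSpace

namespace FreeDivisor

/-! ### The matrix universe, direct sums, ampliations -/

/-- `d`-tuples of complex `n × n` matrices. -/
abbrev Tup (d n : ℕ) : Type := Fin d → Matrix (Fin n) (Fin n) ℂ

/-- The matrix universe: the disjoint union over `n` of `M_n(ℂ)^d`, with the disjoint union topology.
The size `0` is present only as a unit for direct sums; free sets below contain no tuple of size `0`. -/
abbrev MU (d : ℕ) : Type := Σ n : ℕ, Tup d n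

/-- `X ⊕ Y`, the tuple of block diagonal matrices `diag(X_i, Y_i)`. -/
def blockSum {d n m : ℕ} (X : Tup d n) (Y : Tup d m) : Tup d (n + m) := fun i =>
  Matrix.reindex finSumFinEquiv finSumFinEquiv (Matrix.fromBlocks (X i) 0 0 (Y i))

theorem sigma_ext {d n m : ℕ} (h : n = m) (X : Tup d n) (Y : Tup d m)
    (hXY : ∀ i a b, X i a b = Y i (Fin.cast h a) (Fin.cast h b)) :
    (⟨n, X⟩ : MU d) = ⟨m, Y⟩ := by
  subst h
  congr 1
  funext i
  ext a b
  exact hXY i a b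

section entries
variable {d n m : ℕ} (X : Tup d n) (Y : Tup d m) (i : Fin d)

@[simp] theorem blockSum_ll (a b : Fin n) :
    blockSum X Y i (Fin.castAdd m a) (Fin.castAdd m b) = X i a b := by simp [blockSum]
@[simp] theorem blockSum_lr (a : Fin n) (b : Fin m) :
    blockSum X Y i (Fin.castAdd m a) (Fin.natAdd n b) = 0 := by simp [blockSum]
@[simp] theorem blockSum_rl (a : Fin m) (b : Fin n) :
    blockSum X Y i (Fin.natAdd n a) (Fin.castAdd m b) = 0 := by simp [blockSum]
@[simp] theorem blockSum_rr (a b : Fin m) :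
    blockSum X Y i (Fin.natAdd n a) (Fin.natAdd n b) = Y i a b := by simp [blockSum]
end entries

theorem blockSum_assoc {d n m p : ℕ} (X : Tup d n) (Y : Tup d m) (Z : Tup d p) :
    (⟨n + m + p, blockSum (blockSum X Y) Z⟩ : MU d) = ⟨n + (m + p), blockSum X (blockSum Y Z)⟩ := by
  refine sigma_ext (Nat.add_assoc n m p) _ _ fun i a b => ?_
  have e1 : ∀ x : Fin n, Fin.cast (Nat.add_assoc n m p) (Fin.castAdd p (Fin.castAdd m x))
      = Fin.castAdd (m + p) x := fun x => rfl
  have e2 : ∀ x : Fin m, Fin.cast (Nat.add_assoc n m p) (Fin.castAdd p (Fin.natAdd n x))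
      = Fin.natAdd n (Fin.castAdd p x) := fun x => rfl
  have e3 : ∀ x : Fin p, Fin.cast (Nat.add_assoc n m p) (Fin.natAdd (n + m) x)
      = Fin.natAdd n (Fin.natAdd m x) := fun x => Fin.ext (Nat.add_assoc n m x)
  induction a using Fin.addCases with
  | left a =>
    induction a using Fin.addCases <;>
    induction b using Fin.addCases with
    | left b => induction b using Fin.addCases <;> simp only [e1, e2, blockSum_ll, blockSum_lr,
        blockSum_rl, blockSum_rr]
    | right b => simp only [e1, e2, e3, blockSum_lr, blockSum_rr]
  | right a =>
    induction b using Fin.addCases with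
    | left b => induction b using Fin.addCases <;> simp only [e1, e2, e3, blockSum_rl,
        blockSum_rr]
    | right b => simp only [e3, blockSum_rr]

theorem zero_blockSum {d n : ℕ} (O : Tup d 0) (X : Tup d n) :
    (⟨0 + n, blockSum O X⟩ : MU d) = ⟨n, X⟩ := by
  refine sigma_ext (Nat.zero_add n) _ _ fun i a b => ?_
  have e : ∀ x : Fin n, Fin.cast (Nat.zero_add n) (Fin.natAdd 0 x) = x :=
    fun x => Fin.ext (Nat.zero_add x)
  induction a using Fin.addCases with
  | left a => exact a.elim0
  | right a =>
    induction b using Fin.addCases with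
    | left b => exact b.elim0
    | right b => rw [blockSum_rr, e, e]

theorem blockSum_zero {d n : ℕ} (X : Tup d n) (O : Tup d 0) :
    (⟨n + 0, blockSum X O⟩ : MU d) = ⟨n, X⟩ := by
  refine sigma_ext (Nat.add_zero n) _ _ fun i a b => ?_
  induction a using Fin.addCases with
  | right a => exact a.elim0
  | left a =>
    induction b using Fin.addCases with
    | right b => exact b.elim0
    | left b => rw [blockSum_ll]; rfl

/-- Direct sum of tuples, written `X + Y`, is associative with the tuple of size `0` as unit. The
`k`-fold ampliation `X ⊕ ⋯ ⊕ X` is then `k • X`. -/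
instance instAddMonoidMU (d : ℕ) : AddMonoid (MU d) :=
  letI : Add (MU d) := ⟨fun X Y => ⟨X.1 + Y.1, blockSum X.2 Y.2⟩⟩
  letI : Zero (MU d) := ⟨⟨0, 0⟩⟩
  { add_assoc := fun X Y Z => blockSum_assoc X.2 Y.2 Z.2
    zero_add := fun X => zero_blockSum 0 X.2
    add_zero := fun X => blockSum_zero X.2 0
    nsmul := nsmulRec }

theorem mk_add_mk {d n m : ℕ} (X : Tup d n) (Y : Tup d m) :
    (⟨n, X⟩ + ⟨m, Y⟩ : MU d) = ⟨n + m, blockSum X Y⟩ := rfl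

theorem continuous_blockSum {d n m : ℕ} :
    Continuous fun p : Tup d n × Tup d m => blockSum p.1 p.2 := by
  refine continuous_pi fun i => ?_
  refine Continuous.matrix_reindex ?_ _ _
  exact Continuous.matrix_fromBlocks ((continuous_apply i).comp continuous_fst) continuous_const
    continuous_const ((continuous_apply i).comp continuous_snd)

theorem continuous_dsum {d : ℕ} : Continuous fun p : MU d × MU d => p.1 + p.2 := by
  rw [continuous_iff_continuousAt]
  rintro ⟨⟨n, X⟩, ⟨m, Y⟩⟩
  rw [ContinuousAt, nhds_prod_eq, Sigma.nhds_mk, Sigma.nhds_mk, prod_map_map_eq, tendsto_map'_iff,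
    ← nhds_prod_eq]
  exact ((continuous_sigmaMk (σ := Tup d) (i := n + m)).comp
    continuous_blockSum).continuousAt (x := (X, Y))

theorem continuous_amp {d : ℕ} (k : ℕ) : Continuous fun X : MU d => k • X := by
  induction k with
  | zero => simpa only [zero_nsmul] using continuous_const
  | succ k ih =>
    simp only [succ_nsmul]
    exact continuous_dsum.comp (ih.prodMk continuous_id)

/-! ### Free sets -/

/-- `D_n = D ∩ M_n(ℂ)^d`. -/
def slice {d : ℕ} (D : Set (MU d)) (n : ℕ) : Set (Tup d n) := {X | (⟨n, X⟩ : MU d) ∈ D}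

/-- `U* X U = (U* X_1 U, …, U* X_d U)`. -/
def conj {d n : ℕ} (U : Matrix.unitaryGroup (Fin n) ℂ) (X : Tup d n) : Tup d n :=
  fun i => star (U : Matrix (Fin n) (Fin n) ℂ) * X i * (U : Matrix (Fin n) (Fin n) ℂ)

/-- Free sets: sets of tuples of matrices of positive size that are closed under direct sums and
unitary conjugation. -/
structure IsFreeSet {d : ℕ} (D : Set (MU d)) : Prop where
  size_pos : ∀ X ∈ D, 0 < X.1
  add_mem : ∀ X ∈ D, ∀ Y ∈ D, X + Y ∈ D
  conj_mem : ∀ (n : ℕ) (X : Tup d n) (U : Matrix.unitaryGroup (Fin n) ℂ),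
    X ∈ slice D n → conj U X ∈ slice D n

/-- `B` is an anchor of `D`: a nonempty open simply connected free subset of `D`, where simply
connected means that every nonempty `B_n` is simply connected (in particular path connected). -/
structure IsAnchor {d : ℕ} (D B : Set (MU d)) : Prop where
  subset : B ⊆ D
  free : IsFreeSet B
  nonempty : B.Nonempty
  isOpen : ∀ n, IsOpen (slice B n)
  simplyConnected : ∀ n, (slice B n).Nonempty → SimplyConnectedSpace (slice B n)

/-- Anchored sets: connected open free sets that have an anchor. -/
structure IsAnchored {d : ℕ} (D : Set (MU d)) : Prop where
  free : IsFreeSet D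
  isOpen : ∀ n, IsOpen (slice D n)
  connected : ∀ n, IsPreconnected (slice D n)
  exists_anchor : ∃ B, IsAnchor D B

/-! ### Free, determinantal and tracial functions

Functions on `D` are represented by functions on the whole universe of which only the values on
`D` matter. -/

/-- Graded maps `M^d → M^d`: a tuple of size `n` is sent to a tuple of size `n`. -/
abbrev GradedMap (d : ℕ) : Type := (n : ℕ) → Tup d n → Tup d n

/-- `g` is a free function `D → M^d`. -/
structure IsFreeMap {d : ℕ} (D : Set (MU d)) (g : GradedMap d) : Prop where
  map_sum : ∀ (n m : ℕ) (X : Tup d n) (Y : Tup d m), X ∈ slice D n → Y ∈ slice D m →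
    g (n + m) (blockSum X Y) = blockSum (g n X) (g m Y)
  map_conj : ∀ (n : ℕ) (X : Tup d n) (U : Matrix.unitaryGroup (Fin n) ℂ), X ∈ slice D n →
    g n (conj U X) = conj U (g n X)

/-- `g` is an analytic free function `D → M^d` (for an open set `D`). -/
structure IsAnalyticFreeMap {d : ℕ} (D : Set (MU d)) (g : GradedMap d) : Prop
    extends IsFreeMap D g where
  analytic : ∀ n, AnalyticOnNhd ℂ (g n) (slice D n)

/-- `f` is a determinantal free function on `D`. -/
structure IsDeterminantal {d : ℕ} (D : Set (MU d)) (f : MU d → ℂ) : Prop where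
  map_sum : ∀ X ∈ D, ∀ Y ∈ D, f (X + Y) = f X * f Y
  map_conj : ∀ (n : ℕ) (X : Tup d n) (U : Matrix.unitaryGroup (Fin n) ℂ), X ∈ slice D n →
    f ⟨n, conj U X⟩ = f ⟨n, X⟩

/-- `f` is a tracial free function on `D`. -/
structure IsTracial {d : ℕ} (D : Set (MU d)) (f : MU d → ℂ) : Prop where
  map_sum : ∀ X ∈ D, ∀ Y ∈ D, f (X + Y) = f X + f Y
  map_conj : ∀ (n : ℕ) (X : Tup d n) (U : Matrix.unitaryGroup (Fin n) ℂ), X ∈ slice D n →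
    f ⟨n, conj U X⟩ = f ⟨n, X⟩

/-- `f` is continuously differentiable (in the real sense) on each `D_n`. -/
def IsC1 {d : ℕ} (D : Set (MU d)) (f : MU d → ℂ) : Prop :=
  ∀ n, ContDiffOn ℝ 1 (fun X : Tup d n => f ⟨n, X⟩) (slice D n)

/-- `tr (H · A) = tr ∑ i, H_i A_i`. -/
def pairing {d n : ℕ} (H A : Tup d n) : ℂ := Matrix.trace (∑ i, H i * A i)

/-- `∇ f = g` on the open set `D`: `Df(X)[H] = tr (H · g(X))` for `X ∈ D`. -/
def HasFreeGradient {d : ℕ} (D : Set (MU d)) (f : MU d → ℂ) (g : GradedMap d) : Prop :=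
  ∀ (n : ℕ) (X : Tup d n), X ∈ slice D n →
    DifferentiableAt ℝ (fun Y : Tup d n => f ⟨n, Y⟩) X ∧
    ∀ H : Tup d n, fderiv ℝ (fun Y : Tup d n => f ⟨n, Y⟩) X H = pairing H (g n X)

/-- `div f = ∇ log f = g` on `D ∖ {f = 0}`: `D(log f)(X)[H] = tr (H · g(X))` there. The derivative
of any local branch of `log f` is `f(X)⁻¹ Df(X)[H]`. -/
def HasDivisor {d : ℕ} (D : Set (MU d)) (f : MU d → ℂ) (g : GradedMap d) : Prop :=
  ∀ (n : ℕ) (X : Tup d n), X ∈ slice D n → f ⟨n, X⟩ ≠ 0 →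
    DifferentiableAt ℝ (fun Y : Tup d n => f ⟨n, Y⟩) X ∧
    ∀ H : Tup d n,
      (f ⟨n, X⟩)⁻¹ * fderiv ℝ (fun Y : Tup d n => f ⟨n, Y⟩) X H = pairing H (g n X)

/-! ### First tracial cohomology -/

theorem blockSum_add {d n m : ℕ} (X X' : Tup d n) (Y Y' : Tup d m) :
    blockSum (X + X') (Y + Y') = blockSum X Y + blockSum X' Y' := by
  funext i
  ext a b
  induction a using Fin.addCases <;> induction b using Fin.addCases <;> simp

theorem blockSum_smul {d n m : ℕ} (c : ℂ) (X : Tup d n) (Y : Tup d m) :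
    blockSum (c • X) (c • Y) = c • blockSum X Y := by
  funext i
  ext a b
  induction a using Fin.addCases <;> induction b using Fin.addCases <;> simp

theorem conj_add {d n : ℕ} (U : Matrix.unitaryGroup (Fin n) ℂ) (X Y : Tup d n) :
    conj U (X + Y) = conj U X + conj U Y := by
  funext i; simp [conj, mul_add, add_mul]

theorem conj_smul {d n : ℕ} (U : Matrix.unitaryGroup (Fin n) ℂ) (c : ℂ) (X : Tup d n) :
    conj U (c • X) = c • conj U X := by
  funext i; simp [conj]

theorem pairing_add {d n : ℕ} (H A B : Tup d n) :
    pairing H (A + B) = pairing H A + pairing H B := by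
  simp [pairing, mul_add, Finset.sum_add_distrib]

theorem pairing_smul {d n : ℕ} (c : ℂ) (H A : Tup d n) :
    pairing H (c • A) = c * pairing H A := by
  simp [pairing, ← Finset.smul_sum]

theorem pairing_zero {d n : ℕ} (H : Tup d n) : pairing H 0 = 0 := by simp [pairing]

theorem IsFreeMap.add {d : ℕ} {D : Set (MU d)} {g h : GradedMap d} (hg : IsFreeMap D g)
    (hh : IsFreeMap D h) : IsFreeMap D (g + h) where
  map_sum n m X Y hX hY := by
    simp only [Pi.add_apply (f := g), Pi.add_apply (f := g _), hg.map_sum n m X Y hX hY,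
      hh.map_sum n m X Y hX hY, blockSum_add]
  map_conj n X U hX := by
    simp only [Pi.add_apply (f := g), Pi.add_apply (f := g _), hg.map_conj n X U hX,
      hh.map_conj n X U hX, conj_add]

theorem IsFreeMap.smul {d : ℕ} {D : Set (MU d)} {g : GradedMap d} (c : ℂ) (hg : IsFreeMap D g) :
    IsFreeMap D (c • g) where
  map_sum n m X Y hX hY := by
    simp only [Pi.smul_apply (f := g), Pi.smul_apply (f := g _), hg.map_sum n m X Y hX hY,
      blockSum_smul]
  map_conj n X U hX := by
    simp only [Pi.smul_apply (f := g), Pi.smul_apply (f := g _), hg.map_conj n X U hX, conj_smul]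

theorem IsFreeMap.zero {d : ℕ} (D : Set (MU d)) : IsFreeMap D 0 := by
  constructor
  · intro n m X Y _ _
    funext i
    ext a b
    induction a using Fin.addCases <;> induction b using Fin.addCases <;> simp
  · intro n X U _
    funext i
    simp [conj]

/-- The vector space of closed analytic free functions `g : D → M^d`:
`tr (K · Dg(X)[H]) = tr (H · Dg(X)[K])`. -/
def closedMaps {d : ℕ} (D : Set (MU d)) : Submodule ℂ (GradedMap d) where
  carrier := {g | IsAnalyticFreeMap D g ∧ ∀ (n : ℕ) (X : Tup d n), X ∈ slice D n →
    ∀ H K : Tup d n, pairing K (fderiv ℂ (g n) X H) = pairing H (fderiv ℂ (g n) X K)}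
  zero_mem' := by
    refine ⟨⟨IsFreeMap.zero D, fun n X _ => analyticAt_const⟩, fun n X _ H K => ?_⟩
    have e : fderiv ℂ ((0 : GradedMap d) n) X = 0 := fderiv_const_apply (0 : Tup d n)
    rw [e, zero_apply, zero_apply, pairing_zero,
      pairing_zero]
  add_mem' := by
    rintro g h ⟨hg, hg'⟩ ⟨hh, hh'⟩
    refine ⟨⟨hg.1.add hh.1, fun n => (hg.analytic n).add (hh.analytic n)⟩, fun n X hX H K => ?_⟩
    have e : fderiv ℂ ((g + h) n) X = fderiv ℂ (g n) X + fderiv ℂ (h n) X :=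
      fderiv_add (hg.analytic n X hX).differentiableAt (hh.analytic n X hX).differentiableAt
    rw [e, add_apply, add_apply, pairing_add, pairing_add,
      hg' n X hX, hh' n X hX]
  smul_mem' := by
    rintro c g ⟨hg, hg'⟩
    refine ⟨⟨hg.1.smul c, fun n X hX => (analyticAt_const (v := c)).smul (hg.analytic n X hX)⟩,
      fun n X hX H K => ?_⟩
    have e : fderiv ℂ ((c • g) n) X = c • fderiv ℂ (g n) X :=
      fderiv_const_smul (hg.analytic n X hX).differentiableAt c
    rw [e, smul_apply, smul_apply, pairing_smul,
      pairing_smul, hg' n X hX]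

/-- The vector space of exact free functions: free gradients of tracial free functions on `D`. -/
def exactMaps {d : ℕ} (D : Set (MU d)) : Submodule ℂ (GradedMap d) where
  carrier := {g | IsFreeMap D g ∧ ∃ f : MU d → ℂ, IsTracial D f ∧ HasFreeGradient D f g}
  zero_mem' := by
    refine ⟨IsFreeMap.zero D, fun _ => 0, ⟨fun _ _ _ _ => by simp, fun _ _ _ _ => rfl⟩,
      fun n X _ => ⟨differentiableAt_const _, fun H => ?_⟩⟩
    rw [fderiv_const_apply, zero_apply]
    exact (pairing_zero H).symm
  add_mem' := by
    rintro g h ⟨hg, f, hf, hfg⟩ ⟨hh, k, hk, hkh⟩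
    refine ⟨hg.add hh, fun X => f X + k X, ⟨fun X hX Y hY => ?_, fun n X U hX => ?_⟩,
      fun n X hX => ⟨(hfg n X hX).1.add (hkh n X hX).1, fun H => ?_⟩⟩
    · rw [hf.map_sum X hX Y hY, hk.map_sum X hX Y hY]; ring
    · rw [hf.map_conj n X U hX, hk.map_conj n X U hX]
    · have e := fderiv_add (hfg n X hX).1 (hkh n X hX).1
      have e' : pairing H ((g + h) n X) = pairing H (g n X) + pairing H (h n X) :=
        pairing_add H (g n X) (h n X)
      rw [e', ← (hfg n X hX).2 H, ← (hkh n X hX).2 H, ← add_apply]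
      exact DFunLike.congr_fun e H
  smul_mem' := by
    rintro c g ⟨hg, f, hf, hfg⟩
    refine ⟨hg.smul c, fun X => c * f X, ⟨fun X hX Y hY => ?_, fun n X U hX => ?_⟩,
      fun n X hX => ⟨(hfg n X hX).1.const_mul c, fun H => ?_⟩⟩
    · rw [hf.map_sum X hX Y hY]; ring
    · rw [hf.map_conj n X U hX]
    · have e := fderiv_const_mul (hfg n X hX).1 c
      have e' : pairing H ((c • g) n X) = c * pairing H (g n X) := pairing_smul c H (g n X)
      rw [e', ← (hfg n X hX).2 H]
      exact DFunLike.congr_fun e H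

/-- `H¹_tr(D)`, closed free functions modulo exact free functions. -/
abbrev H1tr {d : ℕ} (D : Set (MU d)) : Type :=
  closedMaps D ⧸ (exactMaps D).submoduleOf (closedMaps D)

/-! ### Analytic continuation along paths and global germs -/

/-- The family `F t` of functions is an analytic continuation of `f` along `γ`: each `F t` is
analytic near `γ t`, `F 0` agrees with `f` near `γ 0`, and for `s` near `t` the functions `F s` and
`F t` agree near `γ s`. -/
structure IsContinuation {d : ℕ} (f : MU d → ℂ) {x y : MU d} (γ : Path x y)
    (F : unitInterval → MU d → ℂ) : Prop where
  analytic : ∀ t, AnalyticAt ℂ (fun Y : Tup d (γ t).1 => F t ⟨(γ t).1, Y⟩) (γ t).2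
  start : F 0 =ᶠ[𝓝 (γ 0)] f
  coherent : ∀ t, ∀ᶠ s in 𝓝 t, F s =ᶠ[𝓝 (γ s)] F t

open Classical in
/-- The value at `γ 1` of the (unique) analytic continuation of `f` along `γ`. -/
noncomputable def continuedValue {d : ℕ} (f : MU d → ℂ) {x y : MU d} (γ : Path x y) : ℂ :=
  if h : ∃ F, IsContinuation f γ F then h.choose 1 (γ 1) else 0

/-- `f` is a global germ: a tracial free function on `B` that continues analytically along every
path in `D` that starts in `B`. -/
structure IsGlobalGerm {d : ℕ} (D B : Set (MU d)) (f : MU d → ℂ) : Prop where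
  tracial : IsTracial B f
  continues : ∀ (x y : MU d) (γ : Path x y), x ∈ B → (∀ t, γ t ∈ D) →
    ∃ F, IsContinuation f γ F

/-! ### Paths essentially taking one point to another -/

/-- Paths in `D` that essentially take `X` to `Y`: from `X^{⊕k}` to `Y^{⊕l}`, `k, l ≥ 1`. -/
structure EssPath {d : ℕ} (D : Set (MU d)) (X Y : D) where
  k : ℕ
  l : ℕ
  k_pos : 0 < k
  l_pos : 0 < l
  path : Path (k • (X : MU d)) (l • (Y : MU d))
  mem : ∀ t, path t ∈ D

theorem nsmul_mem {d : ℕ} {D : Set (MU d)} (hD : IsFreeSet D) {X : MU d} (hX : X ∈ D) {k : ℕ}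
    (hk : 0 < k) : k • X ∈ D := by
  induction k, hk using Nat.le_induction with
  | base => simpa using hX
  | succ k _ ih => rw [succ_nsmul]; exact hD.add_mem _ ih _ hX

theorem amp_swap {d : ℕ} (a b : ℕ) (X : MU d) : a • (b • X) = b • (a • X) := by
  rw [← mul_nsmul', ← mul_nsmul]

namespace EssPath
variable {d : ℕ} {D : Set (MU d)}

/-- The trivial path `γ^X`. -/
noncomputable def refl (X : D) : EssPath D X X where
  k := 1
  l := 1
  k_pos := one_pos
  l_pos := one_pos
  path := Path.refl _
  mem _ := by simp

/-- The reversed path. -/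
noncomputable def symm {X Y : D} (γ : EssPath D X Y) : EssPath D Y X where
  k := γ.l
  l := γ.k
  k_pos := γ.l_pos
  l_pos := γ.k_pos
  path := γ.path.symm
  mem _ := γ.mem _

/-- The concatenation product `γ₂ γ₁`: first `γ₁^{⊕m₂}`, then `γ₂^{⊕m₁}`, where `m₂` is the
multiplicity of `Y` at the start of `γ₂` and `m₁` the multiplicity of `Y` at the end of `γ₁`. -/
noncomputable def comp (hD : IsFreeSet D) {X Y Z : D} (γ₂ : EssPath D Y Z) (γ₁ : EssPath D X Y) :
    EssPath D X Z where
  k := γ₂.k * γ₁.k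
  l := γ₁.l * γ₂.l
  k_pos := Nat.mul_pos γ₂.k_pos γ₁.k_pos
  l_pos := Nat.mul_pos γ₁.l_pos γ₂.l_pos
  path := ((γ₁.path.map (continuous_amp γ₂.k)).trans
    ((γ₂.path.map (continuous_amp γ₁.l)).cast (amp_swap _ _ _) rfl)).cast
      (mul_nsmul' _ _ _) (mul_nsmul' _ _ _)
  mem t := by
    simp only [Path.cast_coe, Path.trans_apply]
    split_ifs
    · exact nsmul_mem hD (γ₁.mem _) γ₂.k_pos
    · exact nsmul_mem hD (γ₂.mem _) γ₁.l_pos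

/-- The `n`-fold product `γ ⋯ γ` of a loop with itself. -/
noncomputable def iter (hD : IsFreeSet D) {X : D} (γ : EssPath D X X) : ℕ → EssPath D X X
  | 0 => refl X
  | n + 1 => comp hD γ (iter hD γ n)

/-- `f(γ)`: the value of `f` continued along `γ`, times `1/l`. -/
noncomputable def eval (f : MU d → ℂ) {X Y : D} (γ : EssPath D X Y) : ℂ :=
  (γ.l : ℂ)⁻¹ * continuedValue f γ.path

/-- The path lies inside `D_n`. -/
def InLevel {X Y : D} (γ : EssPath D X Y) (n : ℕ) : Prop := ∀ t, (γ.path t).1 = n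

end EssPath

/-! ### The tracial fundamental group and integral cohomology -/

/-- Trace equivalence of paths essentially taking `X` to `Y`: `f(γ₃γ₁) = f(γ₃γ₂)` for every global
germ `f` and every path `γ₃` essentially taking `Y` to some `Z ∈ D`. -/
def traceSetoid {d : ℕ} {D : Set (MU d)} (hD : IsFreeSet D) (B : Set (MU d)) (X Y : D) :
    Setoid (EssPath D X Y) where
  r γ₁ γ₂ := ∀ f, IsGlobalGerm D B f → ∀ (Z : D) (γ₃ : EssPath D Y Z),
    (γ₃.comp hD γ₁).eval f = (γ₃.comp hD γ₂).eval f
  iseqv := ⟨fun _ _ _ _ _ => rfl, fun h f hf Z γ₃ => (h f hf Z γ₃).symm,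
    fun h h' f hf Z γ₃ => (h f hf Z γ₃).trans (h' f hf Z γ₃)⟩

/-- `π₁^tr(D)` for the anchor `B` and the anchor point `X`. -/
def Pi1tr {d : ℕ} {D : Set (MU d)} (hD : IsFreeSet D) (B : Set (MU d)) (X : D) : Type :=
  Quotient (traceSetoid hD B X X)

/-- The class of a loop in `π₁^tr(D)`. -/
def Pi1tr.mk {d : ℕ} {D : Set (MU d)} (hD : IsFreeSet D) (B : Set (MU d)) {X : D}
    (γ : EssPath D X X) : Pi1tr hD B X := Quotient.mk (traceSetoid hD B X X) γ

/-- `π₁^tr(D)_n`: the classes of paths inside `D_n`. -/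
def pi1Level {d : ℕ} {D : Set (MU d)} (hD : IsFreeSet D) (B : Set (MU d)) (X : D) (n : ℕ) :
    Set (Pi1tr hD B X) :=
  {c | ∃ γ : EssPath D X X, γ.InLevel n ∧ Pi1tr.mk hD B γ = c}

/-- Loops generated, under products and inverses, by the `n`-fold products `γ ⋯ γ` (that is, `nγ`
in additive notation) of loops `γ` whose class lies in `π₁^tr(D)_n`, `n ≥ 1`. -/
inductive IsIntegralLoop {d : ℕ} {D : Set (MU d)} (hD : IsFreeSet D) (B : Set (MU d)) (X : D) :
    EssPath D X X → Prop
  | refl : IsIntegralLoop hD B X (EssPath.refl X)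
  | gen (n : ℕ) (hn : 0 < n) (γ : EssPath D X X) (hγ : Pi1tr.mk hD B γ ∈ pi1Level hD B X n) :
      IsIntegralLoop hD B X (γ.iter hD n)
  | comp (γ₂ γ₁ : EssPath D X X) (h₂ : IsIntegralLoop hD B X γ₂)
      (h₁ : IsIntegralLoop hD B X γ₁) : IsIntegralLoop hD B X (γ₂.comp hD γ₁)
  | symm (γ : EssPath D X X) (h : IsIntegralLoop hD B X γ) : IsIntegralLoop hD B X γ.symm

/-- `π₁^tr(D)_ℤ = ∑ n π₁^tr(D)_n`, as a subset of `π₁^tr(D)`: the classes of the loops generated by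
the `nγ`, `γ ∈ π₁^tr(D)_n`. -/
def pi1Int {d : ℕ} {D : Set (MU d)} (hD : IsFreeSet D) (B : Set (MU d)) (X : D) :
    Set (Pi1tr hD B X) :=
  {c | ∃ γ : EssPath D X X, IsIntegralLoop hD B X γ ∧ Pi1tr.mk hD B γ = c}

/-- `φ_c(γ) = z` for `c ∈ H¹_tr(D)`: `z = (f(γ) - f(γ^X)) / (size of X)` where `f` is a global germ
such that `∇ f` on `B` is the restriction of a closed free function of class `c`. -/
def IsPeriod {d : ℕ} {D : Set (MU d)} (B : Set (MU d)) (X : D) (c : H1tr D)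
    (γ : EssPath D X X) (z : ℂ) : Prop :=
  ∃ (g : closedMaps D) (f : MU d → ℂ), (Submodule.Quotient.mk g : H1tr D) = c ∧
    IsGlobalGerm D B f ∧ HasFreeGradient B f g ∧
    z = (γ.eval f - (EssPath.refl X).eval f) / ((X : MU d).1 : ℂ)

/-- `H¹_tr(D)_ℤ`: the classes `c` such that `φ_c(γ) ∈ ℤ` for all `γ ∈ π₁^tr(D)_ℤ`. -/
def H1trInt {d : ℕ} {D : Set (MU d)} (hD : IsFreeSet D) (B : Set (MU d)) (X : D) :
    Set (H1tr D) :=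
  {c | ∀ γ : EssPath D X X, Pi1tr.mk hD B γ ∈ pi1Int hD B X → ∃ k : ℤ, IsPeriod B X c γ (k : ℂ)}

end FreeDivisor

/-! Put h = g/(2πi) and integrate the one-form H ↦ tr ∑ H_i h_i along paths.

If div f = g, then log f/(2πi) is a local primitive of h, so h is closed. Around a loop based at n•X
the primitive changes by an integer, because f returns to its value (`exists_int_of_hasDivisor`).
For a loop inside D_n the period is this increment divided by the multiplicity n, so n times the
period is an integer. Products and inverses preserve integrality
(`HasPeriod.exists_int_of_isIntegralLoop`).

Conversely, let V(Y) be the integral of h along a path in D_n from n•X to Y. Two paths differ by a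
loop in D_n, and integrality of the class makes the two values of V differ by an integer
(`Reaches.sub_eq_int`); hence f = exp(2πiV) is well defined, with logarithmic derivative g. It is
multiplicative because direct sums of such paths again start at a multiple of X and the trace splits
over blocks. It is invariant under conjugation because X has size one: n•X is scalar, so a
conjugated path keeps its starting point.

The definitions of periods and trace equivalence speak of continued germs. Continuing a primitive
along a path amounts to integrating h (`HasIncrement.continuedValue_eq`), and simple connectivity of
the anchor supplies a tracial germ with gradient h (`exists_isTracial_isLocalPrimitive`). Periods
then depend only on the trace class of the loop (`HasPeriod.congr_of_mk_eq`) and on the cohomology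
class (`IsPeriod.hasPeriod`). -/

namespace FreeDivisor

/-! ### Primitives of analytic one-forms -/

section forms
variable {E : Type*} [NormedAddCommGroup E] [NormedSpace ℂ E]

/-- A function whose derivative is given by an analytic one-form is analytic. -/
theorem analyticAt_of_hasFDerivAt {ω : E → E →L[ℂ] ℂ} {P : E → ℂ} {x : E}
    (hω : AnalyticAt ℂ ω x) (hP : ∀ᶠ y in 𝓝 x, HasFDerivAt P (ω y) y) : AnalyticAt ℂ P x := by
  obtain ⟨p, r, hp⟩ := hω
  obtain ⟨δ, hδ, hPδ⟩ := Metric.eventually_nhds_iff_ball.1 hP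
  -- Integrating the n-th term of ω over the segment from x to x + y gives the factor ∫₀¹ tⁿ dt =
  -- 1/(n+1).
  set q : FormalMultilinearSeries ℂ E (E →L[ℂ] ℂ) := fun n => ((n : ℂ) + 1)⁻¹ • p n with hq
  have hqr : p.radius ≤ q.radius := by
    refine FormalMultilinearSeries.radius_le_of_le fun n => ?_
    rw [hq]
    simp only [norm_smul, norm_inv]
    refine mul_le_of_le_one_left (norm_nonneg _) (inv_le_one_of_one_le₀ ?_)
    have : ‖((n : ℂ) + 1)‖ = (n : ℝ) + 1 := by
      rw [← Nat.cast_succ, Complex.norm_natCast, Nat.cast_succ]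
    rw [this]
    linarith [(Nat.cast_nonneg n : (0 : ℝ) ≤ n)]
  have hq0 : 0 < q.radius := (hp.r_pos.trans_le hp.r_le).trans_le hqr
  have hG : AnalyticAt ℂ q.sum 0 := (q.hasFPowerSeriesOnBall hq0).analyticAt
  -- The increment of P is the integral of ω over the segment, computed term by term.
  have key : ∀ᶠ y in 𝓝 (0 : E), P (x + y) = P x + q.sum y y := by
    have h1 : ∀ᶠ y in 𝓝 (0 : E), y ∈ Metric.eball (0 : E) r := Metric.eball_mem_nhds _ hp.r_pos
    have h2 : ∀ᶠ y in 𝓝 (0 : E), y ∈ Metric.ball (0 : E) δ := Metric.ball_mem_nhds _ hδ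
    filter_upwards [h1, h2] with y hy1 hy2
    have hsmul : ∀ t ∈ Set.Icc (0 : ℝ) 1, (t : ℂ) • y ∈ Metric.eball (0 : E) r := by
      intro t ht
      rw [Metric.mem_eball, edist_zero_right] at hy1 ⊢
      refine lt_of_le_of_lt ?_ hy1
      rw [← ofReal_norm, ← ofReal_norm]
      refine ENNReal.ofReal_le_ofReal ?_
      rw [norm_smul, Complex.norm_real, Real.norm_of_nonneg ht.1]
      exact mul_le_of_le_one_left (norm_nonneg _) ht.2
    have hder : ∀ t ∈ Set.uIcc (0 : ℝ) 1,
        HasDerivAt (fun t : ℝ => P (x + (t : ℂ) • y)) (ω (x + (t : ℂ) • y) y) t := by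
      intro t ht
      rw [Set.uIcc_of_le zero_le_one] at ht
      have hb : x + (t : ℂ) • y ∈ Metric.ball x δ := by
        rw [Metric.mem_ball, dist_self_add_left, norm_smul, Complex.norm_real,
          Real.norm_of_nonneg ht.1]
        rw [Metric.mem_ball, dist_zero_right] at hy2
        exact (mul_le_of_le_one_left (norm_nonneg _) ht.2).trans_lt hy2
      have h3 : HasDerivAt (fun t : ℂ => x + t • y) y (t : ℂ) := by
        simpa using ((hasDerivAt_id (t : ℂ)).smul_const y).const_add x
      exact ((hPδ _ hb).comp_hasDerivAt (t : ℂ) h3).comp_ofReal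
    have hterm : ∀ n : ℕ, ∀ t ∈ Set.Icc (0 : ℝ) 1,
        (p n (fun _ => (t : ℂ) • y)) y = (t : ℂ) ^ n * (p n (fun _ => y)) y := by
      intro n t _
      have := (p n).map_smul_univ (fun _ => (t : ℂ)) (fun _ => y)
      rw [this]
      simp
    have hsum : ∀ t ∈ Set.Icc (0 : ℝ) 1,
        HasSum (fun n => (t : ℂ) ^ n * (p n (fun _ => y)) y) (ω (x + (t : ℂ) • y) y) := by
      intro t ht
      have := (hp.hasSum (hsmul t ht)).mapL (ContinuousLinearMap.apply ℂ ℂ y)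
      refine this.congr_fun fun n => ?_
      exact (hterm n t ht).symm
    have hcont : IntervalIntegrable (fun t : ℝ => ω (x + (t : ℂ) • y) y) MeasureTheory.volume 0 1 := by
      refine ContinuousOn.intervalIntegrable fun t ht => ?_
      rw [Set.uIcc_of_le zero_le_one] at ht
      have hA : ContinuousAt ω (x + (t : ℂ) • y) := by
        refine hp.continuousOn.continuousAt (Metric.isOpen_eball.mem_nhds ?_)
        have := hsmul t ht
        simpa [Metric.mem_eball, edist_eq_enorm_sub] using this
      refine ContinuousAt.continuousWithinAt ?_
      refine ContinuousAt.clm_apply ?_ continuousAt_const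
      exact ContinuousAt.comp (f := fun t : ℝ => x + (t : ℂ) • y) hA (by fun_prop)
    have hint := intervalIntegral.integral_eq_sub_of_hasDerivAt hder hcont
    have hs := intervalIntegral.hasSum_integral_of_dominated_convergence
      (a := 0) (b := 1) (μ := MeasureTheory.volume)
      (F := fun (n : ℕ) (t : ℝ) => (t : ℂ) ^ n * (p n (fun _ => y)) y)
      (f := fun t : ℝ => ω (x + (t : ℂ) • y) y) (fun n _ => ‖p n (fun _ => y)‖ * ‖y‖)
      (fun n => (Continuous.aestronglyMeasurable (by fun_prop)))
      (fun n => Eventually.of_forall fun t ht => by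
        rw [Set.uIoc_of_le zero_le_one] at ht
        rw [norm_mul, norm_pow, Complex.norm_real, Real.norm_of_nonneg ht.1.le]
        exact (mul_le_of_le_one_left (norm_nonneg _) (pow_le_one₀ ht.1.le ht.2)).trans
          ((p n (fun _ => y)).le_opNorm y))
      (Eventually.of_forall fun t _ =>
        (p.summable_norm_apply (Metric.eball_subset_eball hp.r_le hy1)).mul_right _)
      intervalIntegrable_const
      (Eventually.of_forall fun t ht => by
        rw [Set.uIoc_of_le zero_le_one] at ht
        exact hsum t ⟨ht.1.le, ht.2⟩)
    rw [hint] at hs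
    have hs2 : HasSum (fun n : ℕ => ((n : ℂ) + 1)⁻¹ * (p n (fun _ => y)) y) (q.sum y y) := by
      have hy3 : y ∈ Metric.eball (0 : E) q.radius :=
        Metric.eball_subset_eball (hp.r_le.trans hqr) hy1
      have := (q.hasSum hy3).mapL (ContinuousLinearMap.apply ℂ ℂ y)
      exact this.congr_fun fun n => rfl
    have := hs.unique (hs2.congr_fun fun n : ℕ => ?_)
    · simp only [Complex.ofReal_one, one_smul, Complex.ofReal_zero, zero_smul, add_zero] at this
      rw [← this]; ring
    · rw [intervalIntegral.integral_mul_const]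
      congr 1
      have e : (∫ t in (0 : ℝ)..1, (t : ℂ) ^ n) = ((∫ t in (0 : ℝ)..1, t ^ n : ℝ) : ℂ) := by
        rw [← intervalIntegral.integral_ofReal]
        simp
      rw [e, integral_pow]
      simp
  have key2 : ∀ᶠ z in 𝓝 x, P x + q.sum (z - x) (z - x) = P z := by
    have ht : Tendsto (fun z => z - x) (𝓝 x) (𝓝 0) := by
      have : ContinuousAt (fun z => z - x) x := by fun_prop
      simpa [ContinuousAt] using this
    filter_upwards [ht.eventually key] with z hz
    rw [← hz]; simp
  refine AnalyticAt.congr ?_ key2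
  have hsub : AnalyticAt ℂ (fun z => z - x) x := analyticAt_id.sub analyticAt_const
  have hG' : AnalyticAt ℂ (fun z => q.sum (z - x)) x :=
    AnalyticAt.fun_comp (by simpa using hG) hsub
  -- Evaluation (L, v) ↦ L v is bilinear and continuous, so it is analytic and preserves analyticity
  -- of its two arguments.
  exact analyticAt_const.add (((ContinuousLinearMap.id ℂ (E →L[ℂ] ℂ)).analyticAt_bilinear
    (q.sum (x - x), x - x)).comp₂ hG' hsub)

/-- A closed analytic one-form has primitives near every point. -/
theorem exists_local_primitive {ω : E → E →L[ℂ] ℂ} {x : E}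
    (hω : ∀ᶠ y in 𝓝 x, DifferentiableAt ℂ ω y ∧
      ∀ H K, fderiv ℂ ω y H K = fderiv ℂ ω y K H) :
    ∃ P : E → ℂ, ∀ᶠ y in 𝓝 x, HasFDerivAt P (ω y) y := by
  obtain ⟨δ, hδ, h⟩ := Metric.eventually_nhds_iff_ball.1 hω
  let : NormedSpace ℝ E := NormedSpace.restrictScalars ℝ ℂ E
  obtain ⟨P, hP⟩ := (convex_ball x δ).exists_forall_hasFDerivAt_of_fderiv_symmetric
    (𝕜 := ℂ) (F := ℂ) (ω := ω) Metric.isOpen_ball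
    (fun y hy => ((h y hy).1.restrictScalars ℝ).differentiableWithinAt) (fun y hy H K => by
      rw [(h y hy).1.fderiv_restrictScalars ℝ]
      exact (h y hy).2 H K)
  exact ⟨P, Metric.eventually_nhds_iff_ball.2 ⟨δ, hδ, hP⟩⟩

/-- Two primitives of the same form differ by a locally constant function. -/
theorem eventually_sub_eq_of_hasFDerivAt {ω : E → E →L[ℂ] ℂ} {P Q : E → ℂ} {x : E}
    (hP : ∀ᶠ y in 𝓝 x, HasFDerivAt P (ω y) y) (hQ : ∀ᶠ y in 𝓝 x, HasFDerivAt Q (ω y) y) :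
    ∀ᶠ y in 𝓝 x, P y - P x = Q y - Q x := by
  obtain ⟨δ, hδ, h⟩ := Metric.eventually_nhds_iff_ball.1 (hP.and hQ)
  let : NormedSpace ℝ E := NormedSpace.restrictScalars ℝ ℂ E
  refine Metric.eventually_nhds_iff_ball.2 ⟨δ, hδ, fun y hy => ?_⟩
  have := Metric.isOpen_ball.is_const_of_fderiv_eq_zero (𝕜 := ℂ) (f := P - Q)
    (convex_ball x δ).isPreconnected
    (fun z hz => ((h z hz).1.sub (h z hz).2).differentiableAt.differentiableWithinAt)
    (fun z hz => by
      rw [((h z hz).1.sub (h z hz).2).fderiv]; simp) hy (Metric.mem_ball_self hδ)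
  simp only [Pi.sub_apply] at this
  linear_combination this

/-- If the derivative of an analytic function agrees with an analytic one-form somewhere on a ball,
it agrees on the whole ball. -/
theorem hasFDerivAt_of_mem_ball {ω : E → E →L[ℂ] ℂ} {P : E → ℂ} {x z : E} {δ : ℝ}
    (hω : AnalyticOnNhd ℂ ω (Metric.ball x δ)) (hPa : AnalyticOnNhd ℂ P (Metric.ball x δ))
    (hz : z ∈ Metric.ball x δ) (hP : ∀ᶠ y in 𝓝 z, HasFDerivAt P (ω y) y) :
    ∀ y ∈ Metric.ball x δ, HasFDerivAt P (ω y) y := by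
  let : NormedSpace ℝ E := NormedSpace.restrictScalars ℝ ℂ E
  have := hPa.fderiv.eqOn_of_preconnected_of_eventuallyEq hω (convex_ball x δ).isPreconnected hz
    (hP.mono fun y hy => hy.fderiv)
  intro y hy
  rw [← this hy]
  exact (hPa y hy).differentiableAt.hasFDerivAt

end forms

/-! ### The one-form of a graded map and its local primitives -/

theorem pairing_add_left {d n : ℕ} (H K A : Tup d n) :
    pairing (H + K) A = pairing H A + pairing K A := by
  simp [pairing, add_mul, Finset.sum_add_distrib]

theorem pairing_smul_left {d n : ℕ} (c : ℂ) (H A : Tup d n) :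
    pairing (c • H) A = c * pairing H A := by
  simp [pairing, ← Finset.smul_sum]

/-- Continuous linear maps for the topologies given by the norms. -/
abbrev NLin (E F : Type*) [NormedAddCommGroup E] [NormedSpace ℂ E] [NormedAddCommGroup F]
    [NormedSpace ℂ F] : Type _ := E →L[ℂ] F

/-- A linear map on a finite-dimensional normed space as a continuous one. -/
noncomputable def NLin.mk {E F : Type*} [NormedAddCommGroup E] [NormedSpace ℂ E]
    [FiniteDimensional ℂ E] [NormedAddCommGroup F] [NormedSpace ℂ F] (f : E →ₗ[ℂ] F) : NLin E F :=
  LinearMap.toContinuousLinearMap f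

/-- A bilinear form on a finite-dimensional normed space as a continuous one. -/
noncomputable def NLin.mk₂ {E : Type*} [NormedAddCommGroup E] [NormedSpace ℂ E]
    [FiniteDimensional ℂ E] (f : E →ₗ[ℂ] E →ₗ[ℂ] ℂ) : NLin E (NLin E ℂ) :=
  NLin.mk ((LinearMap.toContinuousLinearMap (𝕜 := ℂ) (E := E) (F' := ℂ)).toLinearMap ∘ₗ f)

/-- `HasFDerivAt` for the topologies given by the norms. -/
abbrev NHasFDerivAt {E F : Type*} [NormedAddCommGroup E] [NormedSpace ℂ E] [NormedAddCommGroup F]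
    [NormedSpace ℂ F] (f : E → F) (f' : NLin E F) (x : E) : Prop := HasFDerivAt f f' x

/-- The one-form `H ↦ tr (H · A)`, as a continuous bilinear map. -/
noncomputable def form {d n : ℕ} : NLin (Tup d n) (NLin (Tup d n) ℂ) :=
  NLin.mk₂ (LinearMap.mk₂ ℂ (fun A H : Tup d n => pairing H A) (fun A B H => pairing_add H A B)
        (fun c A H => pairing_smul c H A) (fun A H K => pairing_add_left H K A)
        (fun c A H => pairing_smul_left c H A))

/-! ### Compatibility of the pairing with direct sums and conjugation -/

theorem pairing_blockSum {d n m : ℕ} (H A : Tup d n) (K B : Tup d m) :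
    pairing (blockSum H K) (blockSum A B) = pairing H A + pairing K B := by
  simp only [pairing, Matrix.trace_sum, ← Finset.sum_add_distrib]
  refine Finset.sum_congr rfl fun i _ => ?_
  simp [Matrix.trace, Matrix.mul_apply, Fin.sum_univ_add]

theorem pairing_conj {d n : ℕ} (U : Matrix.unitaryGroup (Fin n) ℂ) (H A : Tup d n) :
    pairing (conj U H) (conj U A) = pairing H A := by
  simp only [pairing, Matrix.trace_sum]
  refine Finset.sum_congr rfl fun i _ => ?_
  have hU : (U : Matrix (Fin n) (Fin n) ℂ) * star (U : Matrix (Fin n) (Fin n) ℂ) = 1 :=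
    Matrix.mem_unitaryGroup_iff.1 U.2
  simp only [conj]
  rw [show star (U : Matrix (Fin n) (Fin n) ℂ) * H i * U * (star (U : Matrix (Fin n) (Fin n) ℂ) *
      A i * U) = star (U : Matrix (Fin n) (Fin n) ℂ) * (H i *
        ((U : Matrix (Fin n) (Fin n) ℂ) * star (U : Matrix (Fin n) (Fin n) ℂ)) * A i) * U by
      simp only [mul_assoc], hU, mul_one, Matrix.trace_mul_cycle, ← mul_assoc, hU, one_mul]

/-- Direct sum as a continuous linear map. -/
noncomputable def blockSumL (d n m : ℕ) : NLin (Tup d n × Tup d m) (Tup d (n + m)) :=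
  NLin.mk
    { toFun := fun p => blockSum p.1 p.2
      map_add' := fun _ _ => blockSum_add _ _ _ _
      map_smul' := fun c _ => blockSum_smul c _ _ }

/-- Unitary conjugation as a continuous linear map. -/
noncomputable def conjL {d n : ℕ} (U : Matrix.unitaryGroup (Fin n) ℂ) : NLin (Tup d n) (Tup d n) :=
  NLin.mk
    { toFun := conj U
      map_add' := conj_add U
      map_smul' := conj_smul U }

/-! ### Local primitives on the matrix universe -/

theorem eventually_nhds_mk {d n : ℕ} {X : Tup d n} {p : MU d → Prop} :
    (∀ᶠ y in 𝓝 (⟨n, X⟩ : MU d), p y) ↔ ∀ᶠ Y in 𝓝 X, p ⟨n, Y⟩ := by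
  rw [Sigma.nhds_mk, eventually_map]

/-- `P` has complex derivative `H ↦ tr (H · h)` at `x`. -/
def IsPrimitiveAt {d : ℕ} (h : GradedMap d) (P : MU d → ℂ) (x : MU d) : Prop :=
  NHasFDerivAt (fun Y : Tup d x.1 => P ⟨x.1, Y⟩) (form (h x.1 x.2)) x.2

/-- `P` is a primitive of `h` on a neighbourhood of `x`. -/
def IsLocalPrimitive {d : ℕ} (h : GradedMap d) (P : MU d → ℂ) (x : MU d) : Prop :=
  ∀ᶠ y in 𝓝 x, IsPrimitiveAt h P y

theorem isLocalPrimitive_mk {d n : ℕ} {h : GradedMap d} {P : MU d → ℂ} {X : Tup d n} :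
    IsLocalPrimitive h P ⟨n, X⟩ ↔
      ∀ᶠ Y in 𝓝 X, NHasFDerivAt (fun Y : Tup d n => P ⟨n, Y⟩) (form (h n Y)) Y :=
  eventually_nhds_mk

theorem IsLocalPrimitive.eventually_sub_eq {d : ℕ} {h : GradedMap d} {P Q : MU d → ℂ} {x : MU d}
    (hP : IsLocalPrimitive h P x) (hQ : IsLocalPrimitive h Q x) :
    ∀ᶠ y in 𝓝 x, P y - P x = Q y - Q x := by
  obtain ⟨n, X⟩ := x
  rw [isLocalPrimitive_mk] at hP hQ
  exact eventually_nhds_mk.2 (eventually_sub_eq_of_hasFDerivAt (ω := fun Y => form (h n Y)) hP hQ)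

theorem IsLocalPrimitive.congr {d : ℕ} {h : GradedMap d} {P Q : MU d → ℂ} {x : MU d}
    (hP : IsLocalPrimitive h P x) (hPQ : P =ᶠ[𝓝 x] Q) : IsLocalPrimitive h Q x := by
  obtain ⟨n, X⟩ := x
  rw [isLocalPrimitive_mk] at hP ⊢
  filter_upwards [hP, (eventually_nhds_mk.1 hPQ).eventually_nhds] with Y hY hY'
  exact hY.congr_of_eventuallyEq (hY'.mono fun Z hZ => hZ.symm)

theorem IsLocalPrimitive.add_const {d : ℕ} {h : GradedMap d} {P : MU d → ℂ} {x : MU d}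
    (hP : IsLocalPrimitive h P x) (c : ℂ) : IsLocalPrimitive h (fun y => P y + c) x :=
  hP.mono fun _ hy => HasFDerivAt.add_const c hy

/-- The open slices of `D` make it a neighbourhood of its points. -/
theorem mem_nhds_of_mem {d : ℕ} {D : Set (MU d)} (hDo : ∀ n, IsOpen (slice D n)) {x : MU d}
    (hx : x ∈ D) : D ∈ 𝓝 x := by
  obtain ⟨n, X⟩ := x
  exact eventually_nhds_mk.2 ((hDo n).mem_nhds hx)

theorem analyticAt_form {d : ℕ} {D : Set (MU d)} {h : GradedMap d} (hh : IsAnalyticFreeMap D h)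
    {n : ℕ} {X : Tup d n} (hX : X ∈ slice D n) : AnalyticAt ℂ (fun Y => form (h n Y)) X :=
  (ContinuousLinearMap.analyticAt (form (d := d) (n := n)) _).comp (hh.analytic n X hX)

theorem IsLocalPrimitive.analyticAt {d : ℕ} {D : Set (MU d)} {h : GradedMap d} {P : MU d → ℂ}
    {x : MU d} (hh : IsAnalyticFreeMap D h) (hx : x ∈ D) (hP : IsLocalPrimitive h P x) :
    AnalyticAt ℂ (fun Y : Tup d x.1 => P ⟨x.1, Y⟩) x.2 := by
  obtain ⟨n, X⟩ := x
  exact analyticAt_of_hasFDerivAt (analyticAt_form hh hx) (isLocalPrimitive_mk.1 hP)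

theorem exists_isLocalPrimitive {d : ℕ} {D : Set (MU d)} (hDo : ∀ n, IsOpen (slice D n))
    {h : GradedMap d} (hh : h ∈ closedMaps D) {x : MU d} (hx : x ∈ D) :
    ∃ P, IsLocalPrimitive h P x := by
  obtain ⟨n, X⟩ := x
  obtain ⟨P, hP⟩ := exists_local_primitive (ω := fun Y => form (h n Y)) (x := X) (by
    filter_upwards [(hDo n).mem_nhds hx] with Y hY
    refine ⟨(analyticAt_form hh.1 hY).differentiableAt, fun H K => ?_⟩
    have hd : NHasFDerivAt (h n) (fderiv ℂ (h n) Y) Y :=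
      (hh.1.analytic n Y hY).differentiableAt.hasFDerivAt
    -- Since `form` is linear, the derivative of `form ∘ h` is `form ∘ Dh`, and its symmetry is
    -- exactly closedness of h.
    have e := (HasFDerivAt.comp Y (ContinuousLinearMap.hasFDerivAt (form (d := d) (n := n))) hd).fderiv
    refine (DFunLike.congr_fun (DFunLike.congr_fun e H) K).trans
      (.trans ?_ (DFunLike.congr_fun (DFunLike.congr_fun e K) H).symm)
    exact hh.2 n Y hY H K)
  -- The value 0 at other sizes is irrelevant, since size is locally constant.
  refine ⟨fun y => if e : y.1 = n then P (e ▸ y.2) else 0, isLocalPrimitive_mk.2 ?_⟩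
  simp only [dite_true]
  exact hP

/-- The pullback of a local primitive along L has the same derivative as Q, so they differ near e by
a constant that can be absorbed into P. Direct sum and conjugation are the two choices of L. -/
theorem exists_isLocalPrimitive_comp {E : Type*} [NormedAddCommGroup E] [NormedSpace ℂ E]
    {d N : ℕ} {h : GradedMap d} (L : NLin E (Tup d N)) {Q : E → ℂ} {e : E}
    (hP : ∃ P, IsLocalPrimitive h P ⟨N, L e⟩)
    (hQ : ∀ᶠ z in 𝓝 e, HasFDerivAt Q ((form (h N (L z))).comp L) z) :
    ∃ P, IsLocalPrimitive h P ⟨N, L e⟩ ∧ ∀ᶠ z in 𝓝 e, P ⟨N, L z⟩ = Q z := by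
  obtain ⟨P, hP⟩ := hP
  refine ⟨_, hP.add_const (Q e - P ⟨N, L e⟩), ?_⟩
  have h1 : ∀ᶠ z in 𝓝 e, HasFDerivAt (fun z => P ⟨N, L z⟩) ((form (h N (L z))).comp L) z :=
    (L.continuous.continuousAt.eventually (isLocalPrimitive_mk.1 hP)).mono
      fun z hz => hz.comp z L.hasFDerivAt
  filter_upwards [eventually_sub_eq_of_hasFDerivAt (ω := fun z => (form (h N (L z))).comp L) h1 hQ]
    with z hz
  linear_combination hz

/-- Local primitives of a closed free map are additive up to a constant. -/
theorem IsLocalPrimitive.exists_add {d : ℕ} {D : Set (MU d)} (hD : IsFreeSet D)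
    (hDo : ∀ n, IsOpen (slice D n)) {h : GradedMap d} (hh : h ∈ closedMaps D)
    {P Q : MU d → ℂ} {x y : MU d} (hx : x ∈ D) (hy : y ∈ D)
    (hP : IsLocalPrimitive h P x) (hQ : IsLocalPrimitive h Q y) :
    ∃ R, IsLocalPrimitive h R (x + y) ∧ ∀ᶠ p in 𝓝 (x, y), R (p.1 + p.2) = P p.1 + Q p.2 := by
  obtain ⟨n, X⟩ := x
  obtain ⟨m, Y⟩ := y
  obtain ⟨R, hR, hR'⟩ := exists_isLocalPrimitive_comp (h := h) (blockSumL d n m) (e := (X, Y))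
    (Q := fun p => P ⟨n, p.1⟩ + Q ⟨m, p.2⟩)
    (exists_isLocalPrimitive hDo hh (hD.add_mem _ hx _ hy)) (by
      have hXY : ∀ᶠ p in 𝓝 (X, Y), p.1 ∈ slice D n ∧ p.2 ∈ slice D m :=
        prod_mem_nhds ((hDo n).mem_nhds hx) ((hDo m).mem_nhds hy)
      have h1 := (continuous_fst.tendsto (X, Y)).eventually (isLocalPrimitive_mk.1 hP)
      have h2 := (continuous_snd.tendsto (X, Y)).eventually (isLocalPrimitive_mk.1 hQ)
      filter_upwards [hXY, h1, h2] with p hp hp1 hp2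
      have := (hp1.comp p hasFDerivAt_fst).add (hp2.comp p hasFDerivAt_snd)
      refine this.congr_fderiv ?_
      refine ContinuousLinearMap.ext fun q => ?_
      change pairing q.1 (h n p.1) + pairing q.2 (h m p.2) =
        pairing (blockSum q.1 q.2) (h (n + m) (blockSum p.1 p.2))
      -- The trace of a block diagonal product splits, so the form pulls back under direct sum to
      -- the sum of the two forms.
      rw [hh.1.map_sum n m _ _ hp.1 hp.2, pairing_blockSum])
  refine ⟨R, hR, ?_⟩
  rw [nhds_prod_eq, Sigma.nhds_mk, Sigma.nhds_mk, prod_map_map_eq, eventually_map, ← nhds_prod_eq]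
  exact hR'

/-- Local primitives of a closed free map are invariant under conjugation up to a constant. -/
theorem IsLocalPrimitive.exists_conj {d : ℕ} {D : Set (MU d)} (hD : IsFreeSet D)
    (hDo : ∀ n, IsOpen (slice D n)) {h : GradedMap d} (hh : h ∈ closedMaps D)
    {P : MU d → ℂ} {n : ℕ} (U : Matrix.unitaryGroup (Fin n) ℂ) {X : Tup d n} (hX : X ∈ slice D n)
    (hP : IsLocalPrimitive h P ⟨n, X⟩) :
    ∃ R, IsLocalPrimitive h R ⟨n, conj U X⟩ ∧ ∀ᶠ Y in 𝓝 X, R ⟨n, conj U Y⟩ = P ⟨n, Y⟩ := by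
  refine exists_isLocalPrimitive_comp (h := h) (conjL U) (e := X)
    (Q := fun Y => P ⟨n, Y⟩)
    (exists_isLocalPrimitive hDo hh (hD.conj_mem _ _ U hX)) ?_
  filter_upwards [(hDo n).mem_nhds hX, isLocalPrimitive_mk.1 hP] with Y hY hY'
  refine hY'.congr_fderiv ?_
  refine ContinuousLinearMap.ext fun H => ?_
  change pairing H (h n Y) = pairing (conj U H) (h n (conj U Y))
  rw [hh.1.map_conj n Y U hY, pairing_conj]

/-! ### Primitives along maps -/

/-- `Φ` is a primitive of `h` along `γ`: near each `t` it is the composition of `γ` with a local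
primitive of `h`. -/
def IsPrimitiveAlong {d : ℕ} {T : Type*} [TopologicalSpace T] (h : GradedMap d) (γ : T → MU d)
    (Φ : T → ℂ) : Prop :=
  ∀ t, ∃ P, IsLocalPrimitive h P (γ t) ∧ ∀ᶠ s in 𝓝 t, Φ s = P (γ s)

namespace IsPrimitiveAlong
variable {d : ℕ} {T : Type*} [TopologicalSpace T] {h : GradedMap d} {γ : T → MU d} {Φ Ψ : T → ℂ}

theorem of_isPrimitiveAt {P : MU d → ℂ} (hP : ∀ t, IsLocalPrimitive h P (γ t)) :
    IsPrimitiveAlong h γ fun t => P (γ t) :=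
  fun t => ⟨P, hP t, Eventually.of_forall fun _ => rfl⟩

/-- Local primitives differ by constants, so Φ - Ψ is locally constant on a connected space. -/
theorem sub_eq [PreconnectedSpace T] (hγ : Continuous γ) (hΦ : IsPrimitiveAlong h γ Φ)
    (hΨ : IsPrimitiveAlong h γ Ψ) (s t : T) : Φ s - Φ t = Ψ s - Ψ t := by
  have hl : IsLocallyConstant fun t => Φ t - Ψ t := by
    refine (IsLocallyConstant.iff_eventually_eq _).2 fun t => ?_
    obtain ⟨P, hP, hP'⟩ := hΦ t
    obtain ⟨Q, hQ, hQ'⟩ := hΨ t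
    filter_upwards [hP', hQ', hγ.continuousAt.eventually (hP.eventually_sub_eq hQ)] with s h1 h2 h3
    rw [h1, h2, hP'.self_of_nhds, hQ'.self_of_nhds]
    linear_combination h3
  have := hl.apply_eq_of_preconnectedSpace s t
  linear_combination this

theorem comp {S : Type*} [TopologicalSpace S] {u : S → T} (hΦ : IsPrimitiveAlong h γ Φ)
    (hu : Continuous u) : IsPrimitiveAlong h (fun s => γ (u s)) fun s => Φ (u s) := fun s => by
  obtain ⟨P, hP, hP'⟩ := hΦ (u s)
  exact ⟨P, hP, hu.continuousAt.eventually hP'⟩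

theorem add {D : Set (MU d)} (hD : IsFreeSet D) (hDo : ∀ n, IsOpen (slice D n))
    (hh : h ∈ closedMaps D) {γ' : T → MU d} (hγ : Continuous γ) (hγ' : Continuous γ')
    (hγD : ∀ t, γ t ∈ D) (hγD' : ∀ t, γ' t ∈ D) (hΦ : IsPrimitiveAlong h γ Φ)
    (hΨ : IsPrimitiveAlong h γ' Ψ) :
    IsPrimitiveAlong h (fun t => γ t + γ' t) fun t => Φ t + Ψ t := fun t => by
  obtain ⟨P, hP, hP'⟩ := hΦ t
  obtain ⟨Q, hQ, hQ'⟩ := hΨ t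
  obtain ⟨R, hR, hR'⟩ := hP.exists_add hD hDo hh (hγD t) (hγD' t) hQ
  refine ⟨R, hR, ?_⟩
  filter_upwards [hP', hQ', (hγ.prodMk hγ').continuousAt.eventually hR'] with s h1 h2 h3
  rw [h1, h2, h3]

theorem nsmul {D : Set (MU d)} (hD : IsFreeSet D) (hDo : ∀ n, IsOpen (slice D n))
    (hh : h ∈ closedMaps D) (hγ : Continuous γ) (hγD : ∀ t, γ t ∈ D)
    (hΦ : IsPrimitiveAlong h γ Φ) {k : ℕ} (hk : 0 < k) :
    IsPrimitiveAlong h (fun t => k • γ t) fun t => k * Φ t := by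
  induction k, hk using Nat.le_induction with
  | base => simpa using hΦ
  | succ k hk ih =>
    have := add hD hDo hh ((continuous_amp k).comp hγ) hγ (fun t => nsmul_mem hD (hγD t) hk) hγD
      ih hΦ
    simpa [succ_nsmul, add_mul] using this

theorem conj {D : Set (MU d)} (hD : IsFreeSet D) (hDo : ∀ n, IsOpen (slice D n))
    (hh : h ∈ closedMaps D) {n : ℕ} (U : Matrix.unitaryGroup (Fin n) ℂ) {η : T → Tup d n}
    (hη : Continuous η) (hηD : ∀ t, η t ∈ slice D n)
    (hΦ : IsPrimitiveAlong h (fun t => (⟨n, η t⟩ : MU d)) Φ) :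
    IsPrimitiveAlong h (fun t => (⟨n, FreeDivisor.conj U (η t)⟩ : MU d)) Φ := fun t => by
  obtain ⟨P, hP, hP'⟩ := hΦ t
  obtain ⟨R, hR, hR'⟩ := hP.exists_conj hD hDo hh U (hηD t)
  refine ⟨R, hR, ?_⟩
  filter_upwards [hP', hη.continuousAt.eventually hR'] with s h1 h2
  rw [h1, h2]

end IsPrimitiveAlong

/-! ### Existence of primitives along maps, by lifting to a covering space -/

/-- The complex numbers with the discrete topology. -/
def DiscreteComplex : Type := ℂ

noncomputable instance : AddCommGroup DiscreteComplex := inferInstanceAs (AddCommGroup ℂ)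

instance : TopologicalSpace DiscreteComplex := ⊥

instance : DiscreteTopology DiscreteComplex := ⟨rfl⟩

/-- The covering space of germs of the functions `P i + c`, where `P i` is defined on `U i` and the
differences `P i - P j` are locally constant. -/
noncomputable def germCore {B : Type*} [TopologicalSpace B] (U : B → Set B)
    (hU : ∀ i, IsOpen (U i)) (hU' : ∀ i, i ∈ U i) (P : B → B → DiscreteComplex)
    (hP : ∀ i j, ∀ x ∈ U i ∩ U j, ∀ᶠ y in 𝓝 x, P i y - P j y = P i x - P j x) :
    FiberBundleCore B B DiscreteComplex where
  baseSet := U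
  isOpen_baseSet := hU
  indexAt := id
  mem_baseSet_at := hU'
  -- In chart i the coordinate v stands for the germ at x of P i + v. The same germ is P j + v' with
  -- v' = v + P i x - P j x.
  coordChange i j x v := v + (P i x - P j x)
  coordChange_self i x _ v := by rw [sub_self, add_zero]
  continuousOn_coordChange i j := by
    rintro ⟨x, v⟩ hx
    refine ContinuousAt.continuousWithinAt ?_
    -- The fibre is discrete, so continuity requires a locally constant transition term, which is
    -- what `hP` provides.
    have h1 : ContinuousAt (fun p : B × DiscreteComplex => P i p.1 - P j p.1) (x, v) :=
      continuousAt_const.congr (f := fun _ => P i x - P j x)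
        ((continuous_fst.tendsto (x, v)).eventually
          ((hP i j x hx.1).mono fun y hy => hy.symm))
    have h2 : ContinuousAt (fun q : DiscreteComplex × DiscreteComplex => q.1 + q.2)
      (v, P i x - P j x) := continuous_of_discreteTopology.continuousAt
    exact ContinuousAt.comp (f := fun p : B × DiscreteComplex => (p.2, P i p.1 - P j p.1)) h2
      (continuousAt_snd.prodMk h1)
  coordChange_comp i j k x _ v := by abel

/-- A continuous choice of germ over each γ t is a lift of γ to the covering space of germs. It
exists because T is simply connected and locally path connected. -/
theorem exists_lift_of_locally_const {B : Type*} [TopologicalSpace B] (U : B → Set B)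
    (hU : ∀ i, IsOpen (U i)) (hU' : ∀ i, i ∈ U i) (P : B → B → ℂ)
    (hP : ∀ i j, ∀ x ∈ U i ∩ U j, ∀ᶠ y in 𝓝 x, P i y - P j y = P i x - P j x)
    {T : Type*} [TopologicalSpace T] [SimplyConnectedSpace T] [LocallyPathConnectedSpace T]
    {γ : T → B} (hγ : Continuous γ) (t₀ : T) (c : ℂ) :
    ∃ Φ : T → ℂ, Φ t₀ = c ∧
      ∀ t, ∀ᶠ s in 𝓝 t, Φ s - P (γ t) (γ s) = Φ t - P (γ t) (γ t) := by
  set Z := germCore U hU hU' P hP with hZ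
  have hcov : IsCoveringMap (Bundle.TotalSpace.proj : Z.TotalSpace → B) :=
    FiberBundle.isCoveringMap (F := DiscreteComplex) (E := Z.Fiber)
  -- The coordinate over γ t₀ of the germ with value c there.
  let w : ℂ := c - P (γ t₀) (γ t₀)
  obtain ⟨F, ⟨hF₀, hF⟩, -⟩ := hcov.existsUnique_continuousMap_lifts ⟨γ, hγ⟩ t₀
    (⟨γ t₀, (w : DiscreteComplex)⟩ : Z.TotalSpace) rfl
  have hF' : ∀ t, (F t).1 = γ t := fun t => congrFun hF t
  let v : T → ℂ := fun t => (F t).2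
  refine ⟨fun t => v t + P (γ t) (γ t), ?_, fun t => ?_⟩
  · have hv : v t₀ = w := by
      change ((F t₀).2 : ℂ) = w
      rw [hF₀]
    simp only [hv, w]; ring
  · have hmem : F t ∈ (Z.localTriv (γ t)).source := by
      rw [Z.mem_localTriv_source, hF']
      exact hU' _
    -- In the fixed chart at γ t the coordinate of the lift is continuous with discrete values,
    -- hence constant near t.
    have hc : ContinuousAt (fun s => (Z.localTriv (γ t) (F s)).2) t :=
      continuous_snd.continuousAt.comp
        (((Z.localTriv (γ t)).continuousOn.continuousAt
          ((Z.localTriv (γ t)).open_source.mem_nhds hmem)).comp F.continuous.continuousAt)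
    have hval : ∀ s, (Z.localTriv (γ t) (F s)).2 = v s + (P (γ s) (γ s) - P (γ t) (γ s)) := by
      intro s
      rw [Z.localTriv_apply]
      change v s + (P (F s).1 (F s).1 - P (γ t) (F s).1) = _
      rw [hF']
    have hev := hc
    rw [ContinuousAt, nhds_discrete DiscreteComplex, tendsto_pure] at hev
    filter_upwards [hev] with s hs
    have : v s + (P (γ s) (γ s) - P (γ t) (γ s)) = v t + (P (γ t) (γ t) - P (γ t) (γ t)) :=
      (hval s).symm.trans (hs.trans (hval t))
    change v s + P (γ s) (γ s) - P (γ t) (γ s) = v t + P (γ t) (γ t) - P (γ t) (γ t)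
    linear_combination this

/-- Charts are indexed by the points i of D, with domain the open set of points near which a chosen
P i is a primitive. T will be the unit interval, for paths, or a slice of the anchor, for global
primitives there. -/
theorem exists_isPrimitiveAlong {d : ℕ} {D : Set (MU d)} (hDo : ∀ n, IsOpen (slice D n))
    {h : GradedMap d} (hh : h ∈ closedMaps D) {T : Type*} [TopologicalSpace T]
    [SimplyConnectedSpace T] [LocallyPathConnectedSpace T] {γ : T → MU d} (hγ : Continuous γ)
    (hγD : ∀ t, γ t ∈ D) (t₀ : T) (c : ℂ) : ∃ Φ, IsPrimitiveAlong h γ Φ ∧ Φ t₀ = c := by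
  choose P hP using fun i : D => exists_isLocalPrimitive hDo hh i.2
  obtain ⟨Φ, hΦ₀, hΦ⟩ := exists_lift_of_locally_const
    (fun i : D => {x : D | IsLocalPrimitive h (P i) x})
    (fun i => isOpen_setOfPred_eventually_nhds.preimage continuous_subtype_val)
    (fun i => hP i) (fun i x => P i x)
    (fun i j x hx => by
      have := (hx.1.eventually_sub_eq hx.2)
      filter_upwards [continuous_subtype_val.continuousAt.eventually this] with y hy
      linear_combination hy)
    (hγ.subtype_mk hγD) t₀ c
  refine ⟨Φ, fun t => ⟨_, (hP ⟨γ t, hγD t⟩).add_const (Φ t - P ⟨γ t, hγD t⟩ (γ t)), ?_⟩, hΦ₀⟩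
  filter_upwards [hΦ t] with s hs
  linear_combination hs

theorem closedMaps_anti {d : ℕ} {B D : Set (MU d)} (hBD : B ⊆ D) {h : GradedMap d}
    (hh : h ∈ closedMaps D) : h ∈ closedMaps B :=
  ⟨{ map_sum := fun n m X Y hX hY => hh.1.map_sum n m X Y (hBD hX) (hBD hY)
     map_conj := fun n X U hX => hh.1.map_conj n X U (hBD hX)
     analytic := fun n X hX => hh.1.analytic n X (hBD hX) },
    fun n X hX => hh.2 n X (hBD hX)⟩

/-! ### Tracial primitives -/

theorem locallyPathConnectedSpace_of_isOpen {E : Type*} [NormedAddCommGroup E] [NormedSpace ℂ E]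
    {s : Set E} (hs : IsOpen s) : LocallyPathConnectedSpace s :=
  let : NormedSpace ℝ E := NormedSpace.restrictScalars ℝ ℂ E
  hs.locallyPathConnectedSpace

/-- The tuple of scalar matrices with given scalars. -/
def scalarTup {d : ℕ} (a : Fin d → ℂ) (n : ℕ) : Tup d n := fun i => a i • 1

theorem exists_eq_scalarTup {d : ℕ} {X : MU d} (hX : X.1 = 1) : ∃ a, X = ⟨1, scalarTup a 1⟩ := by
  obtain ⟨n, X⟩ := X
  obtain rfl : n = 1 := hX
  refine ⟨fun i => X i 0 0, ?_⟩
  congr 1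
  funext i
  ext a b
  obtain rfl := Subsingleton.elim a 0
  obtain rfl := Subsingleton.elim b 0
  simp [scalarTup]

theorem nsmul_scalarTup {d : ℕ} (a : Fin d → ℂ) (n : ℕ) :
    n • (⟨1, scalarTup a 1⟩ : MU d) = ⟨n, scalarTup a n⟩ := by
  induction n with
  | zero =>
    rw [zero_nsmul]
    refine sigma_ext rfl _ _ fun i a => a.elim0
  | succ n ih =>
    rw [succ_nsmul, ih, mk_add_mk]
    congr 1
    funext i
    ext p q
    induction p using Fin.addCases <;> induction q using Fin.addCases <;>
    simp [scalarTup, Matrix.one_apply, Fin.ext_iff]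
    all_goals omega

/-- Scalars commute with U. This is why a base point of size one is useful: its ampliations are
fixed by conjugation. -/
theorem conj_scalarTup {d n : ℕ} (a : Fin d → ℂ) (U : Matrix.unitaryGroup (Fin n) ℂ) :
    conj U (scalarTup a n) = scalarTup a n := by
  funext i
  simp [conj, scalarTup]

/-- Each simply connected slice carries a primitive, normalised to vanish at n•X. Both tracial
identities hold up to a constant on a connected set; the constant is 0 because these base points add
under direct sums and are fixed by conjugation. -/
theorem exists_isTracial_isLocalPrimitive {d : ℕ} {B : Set (MU d)} (hB : IsFreeSet B)
    (hBo : ∀ n, IsOpen (slice B n))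
    (hBs : ∀ n, (slice B n).Nonempty → SimplyConnectedSpace (slice B n))
    {h : GradedMap d} (hh : h ∈ closedMaps B) {X : MU d} (hX : X ∈ B) (hX1 : X.1 = 1) :
    ∃ F, IsTracial B F ∧ ∀ x ∈ B, IsLocalPrimitive h F x := by
  classical
  obtain ⟨a, rfl⟩ := exists_eq_scalarTup hX1
  have hmem : ∀ n, 0 < n → scalarTup a n ∈ slice B n := fun n hn => by
    have := nsmul_mem hB hX hn
    rwa [nsmul_scalarTup] at this
  -- The slice of size 0 is empty, so it receives a dummy function.
  have hex : ∀ n, ∃ Φ : slice B n → ℂ, ∀ hn : 0 < n,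
      IsPrimitiveAlong h (fun Y : slice B n => (⟨n, Y⟩ : MU d)) Φ ∧
        Φ ⟨scalarTup a n, hmem n hn⟩ = 0 := by
    intro n
    by_cases hn : 0 < n
    · have := hBs n ⟨_, hmem n hn⟩
      have : LocallyPathConnectedSpace (slice B n) :=
        locallyPathConnectedSpace_of_isOpen (hBo n)
      obtain ⟨Φ, h1, h2⟩ := exists_isPrimitiveAlong hBo hh
        (γ := fun Y : slice B n => (⟨n, Y⟩ : MU d))
        (continuous_sigmaMk.comp continuous_subtype_val) (fun Y => Y.2) ⟨_, hmem n hn⟩ 0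
      exact ⟨Φ, fun _ => ⟨h1, h2⟩⟩
    · exact ⟨0, fun h => absurd h hn⟩
  choose Φ hΦ using hex
  let F : MU d → ℂ := fun x => if hx : x ∈ B then Φ x.1 ⟨x.2, hx⟩ else 0
  have hF : ∀ n (Y : slice B n), F ⟨n, Y⟩ = Φ n Y := fun n Y => dif_pos Y.2
  have hF0 : ∀ n, 0 < n → F ⟨n, scalarTup a n⟩ = 0 := fun n hn =>
    (hF n ⟨_, hmem n hn⟩).trans (hΦ n hn).2
  have hprim : ∀ x ∈ B, IsLocalPrimitive h F x := by
    rintro ⟨n, Y⟩ hY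
    obtain ⟨P, hP, hP'⟩ := (hΦ n (hB.size_pos _ hY)).1 ⟨Y, hY⟩
    refine hP.congr ?_
    refine eventually_nhds_mk.2 ?_
    rw [← (hBo n).isOpenEmbedding_subtypeVal.map_nhds_eq ⟨Y, hY⟩, eventually_map]
    filter_upwards [hP'] with Z hZ
    exact hZ.symm.trans (hF n Z).symm
  refine ⟨F, ⟨?_, ?_⟩, hprim⟩
  · rintro ⟨n, Y⟩ hY ⟨m, Z⟩ hZ
    have hn := hB.size_pos _ hY
    have hm := hB.size_pos _ hZ
    have := hBs n ⟨Y, hY⟩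
    have := hBs m ⟨Z, hZ⟩
    have c1 : Continuous fun p : slice B n × slice B m => (⟨n, p.1⟩ : MU d) :=
      continuous_sigmaMk.comp (continuous_subtype_val.comp continuous_fst)
    have c2 : Continuous fun p : slice B n × slice B m => (⟨m, p.2⟩ : MU d) :=
      continuous_sigmaMk.comp (continuous_subtype_val.comp continuous_snd)
    -- F(Y) + F(Z) and F(Y ⊕ Z) are both primitives along (Y, Z) ↦ Y ⊕ Z on a connected product, so
    -- comparing them at the base points suffices.
    have e1 := IsPrimitiveAlong.add hB hBo hh c1 c2 (fun p => p.1.2) (fun p => p.2.2)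
      (.of_isPrimitiveAt fun p => hprim _ p.1.2) (.of_isPrimitiveAt fun p => hprim _ p.2.2)
    have e2 : IsPrimitiveAlong h
        (fun p : slice B n × slice B m => (⟨n, p.1⟩ : MU d) + ⟨m, p.2⟩) _ :=
      .of_isPrimitiveAt fun p => hprim _ (hB.add_mem _ p.1.2 _ p.2.2)
    have := e1.sub_eq (continuous_dsum.comp (c1.prodMk c2)) e2 (⟨Y, hY⟩, ⟨Z, hZ⟩)
      (⟨_, hmem n hn⟩, ⟨_, hmem m hm⟩)
    simp only [hF0 n hn, hF0 m hm] at this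
    have e3 : (⟨n, scalarTup a n⟩ : MU d) + ⟨m, scalarTup a m⟩ = ⟨n + m, scalarTup a (n + m)⟩ := by
      rw [← nsmul_scalarTup a n, ← nsmul_scalarTup a m, ← add_nsmul, nsmul_scalarTup]
    rw [e3, hF0 _ (Nat.add_pos_left hn m)] at this
    linear_combination -this
  · intro n Y U hY
    have hn := hB.size_pos _ hY
    have := hBs n ⟨Y, hY⟩
    have e1 := IsPrimitiveAlong.conj (T := slice B n) hB hBo hh U continuous_subtype_val
      (fun Y => Y.2) (.of_isPrimitiveAt fun Y => hprim ⟨n, Y⟩ Y.2)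
    have e2 : IsPrimitiveAlong h (fun Y : slice B n => (⟨n, conj U Y⟩ : MU d)) _ :=
      .of_isPrimitiveAt fun Y => hprim _ (hB.conj_mem n Y U Y.2)
    have hU : Continuous (conj U : Tup d n → Tup d n) := (conjL U).continuous
    have hc : Continuous fun Y : slice B n => (⟨n, conj U Y⟩ : MU d) :=
      continuous_sigmaMk.comp (hU.comp continuous_subtype_val)
    have := e1.sub_eq hc e2 ⟨Y, hY⟩ ⟨_, hmem n hn⟩
    simp only [conj_scalarTup, hF0 n hn] at this
    linear_combination -this

/-! ### Increments of primitives along paths -/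

theorem contractibleSpace_unitInterval : ContractibleSpace unitInterval :=
  (convex_Icc (0 : ℝ) 1).contractibleSpace ⟨0, by simp⟩

theorem locallyPathConnectedSpace_unitInterval : LocallyPathConnectedSpace unitInterval := by
  refine LocallyPathConnectedSpace.of_bases (p := fun _ r => (0 : ℝ) < r)
    (s := fun x r => Metric.ball x r) (fun x => Metric.nhds_basis_ball) fun x r hr => ?_
  have hc : Convex ℝ (Metric.ball (x : ℝ) r ∩ Set.Icc 0 1) :=
    (convex_ball _ _).inter (convex_Icc _ _)
  have hp : IsPathConnected (Metric.ball (x : ℝ) r ∩ Set.Icc 0 1) :=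
    hc.isPathConnected ⟨x, Metric.mem_ball_self hr, x.2⟩
  have := hp.preimage_coe (U := Set.Icc (0 : ℝ) 1) Set.inter_subset_right
  convert! this using 1
  ext y
  simp [Subtype.dist_eq]

/-- The increment of primitives of `h` along the path `γ` is `v`. -/
def HasIncrement {d : ℕ} (h : GradedMap d) {x y : MU d} (γ : Path x y) (v : ℂ) : Prop :=
  ∃ Φ, IsPrimitiveAlong h γ Φ ∧ Φ 1 - Φ 0 = v

namespace HasIncrement
variable {d : ℕ} {h : GradedMap d} {x y z : MU d} {v w : ℂ}

theorem unique {γ : Path x y} (h₁ : HasIncrement h γ v) (h₂ : HasIncrement h γ w) : v = w := by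
  obtain ⟨Φ, hΦ, rfl⟩ := h₁
  obtain ⟨Ψ, hΨ, rfl⟩ := h₂
  exact hΦ.sub_eq γ.continuous hΨ 1 0

theorem of_isLocalPrimitive {P : MU d → ℂ} {γ : Path x y} (hP : ∀ t, IsLocalPrimitive h P (γ t)) :
    HasIncrement h γ (P y - P x) :=
  ⟨_, .of_isPrimitiveAt hP, by simp⟩

theorem cast {γ : Path x y} (hγ : HasIncrement h γ v) {x' y' : MU d} (hx : x' = x) (hy : y' = y) :
    HasIncrement h (γ.cast hx hy) v := hγ

theorem symm {γ : Path x y} (hγ : HasIncrement h γ v) : HasIncrement h γ.symm (-v) := by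
  obtain ⟨Φ, hΦ, rfl⟩ := hγ
  exact ⟨_, hΦ.comp unitInterval.continuous_symm, by simp⟩

theorem exists_of_closed {D : Set (MU d)} (hDo : ∀ n, IsOpen (slice D n))
    (hh : h ∈ closedMaps D) (γ : Path x y) (hγ : ∀ t, γ t ∈ D) : ∃ v, HasIncrement h γ v := by
  have := contractibleSpace_unitInterval
  have := locallyPathConnectedSpace_unitInterval
  obtain ⟨Φ, hΦ, -⟩ := exists_isPrimitiveAlong hDo hh γ.continuous hγ 0 0
  exact ⟨_, Φ, hΦ, rfl⟩

/-- A primitive along the concatenation restricts on each half to a primitive along γ or γ', whose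
increment is unique. -/
theorem trans {D : Set (MU d)} (hDo : ∀ n, IsOpen (slice D n)) (hh : h ∈ closedMaps D)
    {γ : Path x y} {γ' : Path y z} (hγD : ∀ t, γ t ∈ D) (hγD' : ∀ t, γ' t ∈ D)
    (hγ : HasIncrement h γ v) (hγ' : HasIncrement h γ' w) :
    HasIncrement h (γ.trans γ') (v + w) := by
  obtain ⟨u, Ψ, hΨ, rfl⟩ := exists_of_closed hDo hh (γ.trans γ') fun t => by
    rw [Path.trans_apply]
    split_ifs
    · exact hγD _
    · exact hγD' _
  refine ⟨Ψ, hΨ, ?_⟩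
  have hu : ∀ t : unitInterval, (t : ℝ) / 2 ∈ unitInterval := fun t =>
    ⟨by linarith [t.2.1], by linarith [t.2.2]⟩
  have hu' : ∀ t : unitInterval, (1 + (t : ℝ)) / 2 ∈ unitInterval := fun t =>
    ⟨by linarith [t.2.1], by linarith [t.2.2]⟩
  have h₁ := hΨ.comp (u := fun t : unitInterval => ⟨t / 2, hu t⟩) (by fun_prop)
  have h₂ := hΨ.comp (u := fun t : unitInterval => ⟨(1 + t) / 2, hu' t⟩) (by fun_prop)
  have e₁ : (fun t : unitInterval => (γ.trans γ') ⟨t / 2, hu t⟩) = γ := by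
    funext t
    have ht : (t : ℝ) / 2 ≤ 1 / 2 := by linarith [t.2.2]
    rw [Path.trans_apply, dif_pos ht]
    congr 1
    exact Subtype.ext (by simp; ring)
  have e₂ : (fun t : unitInterval => (γ.trans γ') ⟨(1 + t) / 2, hu' t⟩) = γ' := by
    funext t
    rw [Path.trans_apply]
    split_ifs with ht
    -- Only the midpoint lies in both halves, and there both paths are at y.
    · have : t = 0 := Subtype.ext (le_antisymm (by simp at ht ⊢; linarith) t.2.1)
      subst this
      simp
    · congr 1
      exact Subtype.ext (by simp; ring)
  rw [e₁] at h₁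
  rw [e₂] at h₂
  rw [unique hγ ⟨_, h₁, rfl⟩, unique hγ' ⟨_, h₂, rfl⟩]
  have a1 : (⟨((0 : unitInterval) : ℝ) / 2, hu 0⟩ : unitInterval) = 0 := Subtype.ext (by simp)
  have a2 : (⟨(1 + ((0 : unitInterval) : ℝ)) / 2, hu' 0⟩ : unitInterval)
      = ⟨((1 : unitInterval) : ℝ) / 2, hu 1⟩ := Subtype.ext (by simp)
  have a3 : (⟨(1 + ((1 : unitInterval) : ℝ)) / 2, hu' 1⟩ : unitInterval) = 1 :=
    Subtype.ext (by norm_num)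
  simp only [a1, a2, a3]
  ring

theorem nsmul {D : Set (MU d)} (hD : IsFreeSet D) (hDo : ∀ n, IsOpen (slice D n))
    (hh : h ∈ closedMaps D) {γ : Path x y} (hγD : ∀ t, γ t ∈ D) (hγ : HasIncrement h γ v) {k : ℕ}
    (hk : 0 < k) : HasIncrement h (γ.map (continuous_amp k)) (k * v) := by
  obtain ⟨Φ, hΦ, rfl⟩ := hγ
  exact ⟨_, hΦ.nsmul hD hDo hh γ.continuous hγD hk, by ring⟩

end HasIncrement

/-! ### Continuation of primitives -/

/-- Identity theorem on a ball around x where G and the form are analytic: agreement of the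
derivative with the form near one point of the ball spreads to x. -/
theorem eventually_isLocalPrimitive_imp {d : ℕ} {D : Set (MU d)} (hDo : ∀ n, IsOpen (slice D n))
    {h : GradedMap d} (hh : IsAnalyticFreeMap D h) {x : MU d} (hx : x ∈ D) {G : MU d → ℂ}
    (hG : AnalyticAt ℂ (fun Y : Tup d x.1 => G ⟨x.1, Y⟩) x.2) :
    ∀ᶠ z in 𝓝 x, IsLocalPrimitive h G z → IsLocalPrimitive h G x := by
  obtain ⟨n, X⟩ := x
  have h1 : ∀ᶠ Y in 𝓝 X, AnalyticAt ℂ (fun Y => form (h n Y)) Y := by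
    filter_upwards [(hDo n).mem_nhds hx] with Y hY using analyticAt_form hh hY
  obtain ⟨δ, hδ, hb⟩ := Metric.eventually_nhds_iff_ball.1 (h1.and hG.eventually_analyticAt)
  refine eventually_nhds_mk.2 ?_
  filter_upwards [Metric.ball_mem_nhds X hδ] with Z hZ hGZ
  rw [isLocalPrimitive_mk] at hGZ ⊢
  exact Metric.eventually_nhds_iff_ball.2 ⟨δ, hδ, hasFDerivAt_of_mem_ball
    (ω := fun Y => form (h n Y)) (fun y hy => (hb y hy).1) (fun y hy => (hb y hy).2) hZ hGZ⟩

/-- Analytic continuation preserves the equation for the derivative: the times at which `G t` is a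
local primitive form a clopen set containing 0. Coherence gives openness and the identity theorem
closedness. -/
theorem IsContinuation.isPrimitiveAlong {d : ℕ} {D : Set (MU d)} (hDo : ∀ n, IsOpen (slice D n))
    {h : GradedMap d} (hh : IsAnalyticFreeMap D h) {f : MU d → ℂ} {x y : MU d} {γ : Path x y}
    (hγ : ∀ t, γ t ∈ D) (hf : IsLocalPrimitive h f x) {G : unitInterval → MU d → ℂ}
    (hG : IsContinuation f γ G) : IsPrimitiveAlong h γ fun t => G t (γ t) := by
  have hcl : IsClopen {t | IsLocalPrimitive h (G t) (γ t)} := by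
    constructor
    · refine isClosed_iff_frequently.2 fun t ht => ?_
      have h1 := γ.continuous.continuousAt.eventually
        (eventually_isLocalPrimitive_imp hDo hh (hγ t) (hG.analytic t))
      obtain ⟨s, hs, h2, h3⟩ := (ht.and_eventually (h1.and (hG.coherent t))).exists
      exact h2 (IsLocalPrimitive.congr hs h3)
    · refine isOpen_iff_eventually.2 fun t ht => ?_
      filter_upwards [γ.continuous.continuousAt.eventually ht.eventually_nhds, hG.coherent t]
        with s h1 h2
      exact IsLocalPrimitive.congr h1 h2.symm
  have huniv := hcl.eq_univ ⟨0, by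
    have : IsLocalPrimitive h f (γ 0) := by rwa [γ.source]
    exact this.congr hG.start.symm⟩
  intro t
  refine ⟨G t, huniv.ge (Set.mem_univ t), ?_⟩
  filter_upwards [hG.coherent t] with s hs using hs.self_of_nhds

theorem exists_isContinuation {d : ℕ} {D : Set (MU d)} (hDo : ∀ n, IsOpen (slice D n))
    {h : GradedMap d} (hh : h ∈ closedMaps D) {f : MU d → ℂ} {x y : MU d} (γ : Path x y)
    (hγ : ∀ t, γ t ∈ D) (hf : IsLocalPrimitive h f x) : ∃ G, IsContinuation f γ G := by
  have := contractibleSpace_unitInterval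
  have := locallyPathConnectedSpace_unitInterval
  obtain ⟨Φ, hΦ, hΦ₀⟩ := exists_isPrimitiveAlong hDo hh γ.continuous hγ 0 (f x)
  choose G hG hG' using hΦ
  -- Primitives with the same value at a point agree near it. The values of Φ fix the additive
  -- constants, so the local primitives fit together.
  have key : ∀ {P Q : MU d → ℂ} {z : MU d}, IsLocalPrimitive h P z → IsLocalPrimitive h Q z →
      P z = Q z → P =ᶠ[𝓝 z] Q := fun hP hQ hPQ => by
    filter_upwards [hP.eventually_sub_eq hQ] with w hw
    linear_combination hw + hPQ
  refine ⟨G, fun t => (hG t).analyticAt hh.1 (hγ t), ?_, fun t => ?_⟩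
  · refine key (hG 0) (by rwa [γ.source]) ?_
    rw [← (hG' 0).self_of_nhds, hΦ₀, γ.source]
  · filter_upwards [γ.continuous.continuousAt.eventually (hG t).eventually_nhds, hG' t]
      with s h1 h2
    refine key (hG s) h1 ?_
    rw [← (hG' s).self_of_nhds, h2]

theorem IsTracial.isGlobalGerm {d : ℕ} {D B : Set (MU d)} (hDo : ∀ n, IsOpen (slice D n))
    {h : GradedMap d} (hh : h ∈ closedMaps D) {f : MU d → ℂ} (hf : IsTracial B f)
    (hfh : ∀ x ∈ B, IsLocalPrimitive h f x) : IsGlobalGerm D B f :=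
  ⟨hf, fun x _ γ hx hγ => exists_isContinuation hDo hh γ hγ (hfh x hx)⟩

/-- `continuedValue` picks some continuation; whichever it is, it is a primitive along γ, and
increments are unique. -/
theorem HasIncrement.continuedValue_eq {d : ℕ} {D : Set (MU d)} (hDo : ∀ n, IsOpen (slice D n))
    {h : GradedMap d} (hh : h ∈ closedMaps D) {f : MU d → ℂ} {x y : MU d} {γ : Path x y} {v : ℂ}
    (hγ : ∀ t, γ t ∈ D) (hf : IsLocalPrimitive h f x) (hv : HasIncrement h γ v) :
    continuedValue f γ = f x + v := by
  have hex := exists_isContinuation hDo hh γ hγ hf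
  rw [continuedValue, dif_pos hex]
  have hG := hex.choose_spec
  have := HasIncrement.unique hv ⟨_, hG.isPrimitiveAlong hDo hh.1 hγ hf, rfl⟩
  have h0 := hG.start.self_of_nhds
  rw [γ.source] at h0
  rw [this, ← h0, γ.source]
  ring

/-! ### Periods of loops -/

theorem size_nsmul {d : ℕ} (k : ℕ) (X : MU d) : (k • X).1 = k * X.1 := by
  induction k with
  | zero => rw [zero_nsmul, zero_mul]; rfl
  | succ k ih =>
    rw [succ_nsmul, add_mul, one_mul, ← ih]
    rfl

theorem size_path {d : ℕ} {x y : MU d} (γ : Path x y) (t : unitInterval) : (γ t).1 = x.1 := by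
  have hc : Continuous fun x : MU d => x.1 :=
    continuous_sigma fun n => (continuous_const (y := n))
  have := PreconnectedSpace.constant (inferInstance : PreconnectedSpace unitInterval)
    (hc.comp γ.continuous) (x := t) (y := 0)
  simpa using this

/-- Size is constant along a path, and k•X, l•X have sizes k, l because X has size one. -/
theorem EssPath.l_eq_k {d : ℕ} {D : Set (MU d)} {X : D} (hX1 : (X : MU d).1 = 1)
    (γ : EssPath D X X) : γ.l = γ.k := by
  have := size_path γ.path 1
  rw [γ.path.target, size_nsmul, size_nsmul, hX1] at this
  simpa using this

theorem IsTracial.map_nsmul {d : ℕ} {B : Set (MU d)} (hB : IsFreeSet B) {f : MU d → ℂ}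
    (hf : IsTracial B f) {x : MU d} (hx : x ∈ B) {k : ℕ} (hk : 0 < k) :
    f (k • x) = k * f x := by
  induction k, hk using Nat.le_induction with
  | base => simp
  | succ k hk ih =>
    rw [succ_nsmul, hf.map_sum _ (nsmul_mem hB hx hk) _ hx, ih]
    push_cast
    ring

/-- The period of `h` along the loop `γ` is `z`: the increment divided by the multiplicity. -/
def HasPeriod {d : ℕ} {D : Set (MU d)} (h : GradedMap d) {X : D} (γ : EssPath D X X) (z : ℂ) :
    Prop := HasIncrement h γ.path (γ.l * z)

namespace HasPeriod
variable {d : ℕ} {D : Set (MU d)} {h : GradedMap d} {X : D} {z w : ℂ} {γ γ' : EssPath D X X}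

theorem exists_of_closed (hDo : ∀ n, IsOpen (slice D n)) (hh : h ∈ closedMaps D)
    (γ : EssPath D X X) : ∃ z, HasPeriod h γ z := by
  obtain ⟨v, hv⟩ := HasIncrement.exists_of_closed hDo hh γ.path γ.mem
  refine ⟨(γ.l : ℂ)⁻¹ * v, ?_⟩
  rwa [HasPeriod, mul_inv_cancel_left₀ (Nat.cast_ne_zero.2 γ.l_pos.ne')]

theorem unique (hz : HasPeriod h γ z) (hw : HasPeriod h γ w) : z = w :=
  mul_left_cancel₀ (Nat.cast_ne_zero.2 γ.l_pos.ne') (HasIncrement.unique hz hw)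

theorem refl (hDo : ∀ n, IsOpen (slice D n)) (hh : h ∈ closedMaps D) :
    HasPeriod h (EssPath.refl X) 0 := by
  obtain ⟨v, Φ, hΦ, -⟩ := HasIncrement.exists_of_closed hDo hh (EssPath.refl X).path
    (EssPath.refl X).mem
  -- The trivial path is constant, so a constant function is a primitive along it.
  refine ⟨fun _ => Φ 0, ?_, by simp⟩
  exact hΦ.comp (u := fun _ => 0) continuous_const

theorem comp (hX1 : (X : MU d).1 = 1) (hD : IsFreeSet D) (hDo : ∀ n, IsOpen (slice D n))
    (hh : h ∈ closedMaps D) (hz : HasPeriod h γ z) (hw : HasPeriod h γ' w) :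
    HasPeriod h (γ.comp hD γ') (z + w) := by
  have h1 := HasIncrement.nsmul hD hDo hh γ'.mem hw γ.k_pos
  have h2 := (HasIncrement.nsmul hD hDo hh γ.mem hz γ'.l_pos).cast
    (amp_swap γ.k γ'.l (X : MU d)) rfl
  have h3 := HasIncrement.trans hDo hh (fun t => nsmul_mem hD (γ'.mem t) γ.k_pos)
    (fun t => nsmul_mem hD (γ.mem t) γ'.l_pos) h1 h2
  have h4 := h3.cast (mul_nsmul' (X : MU d) γ.k γ'.k) (mul_nsmul' (X : MU d) γ'.l γ.l)
  -- The first leg is scaled by γ.k and the second by γ'.l. Since γ.k = γ.l, both contribute with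
  -- the factor γ'.l * γ.l.
  have e : ((γ.k : ℂ) * (γ'.l * w) + γ'.l * (γ.l * z)) = ((γ.comp hD γ').l : ℂ) * (z + w) := by
    have : (γ.comp hD γ').l = γ'.l * γ.l := rfl
    rw [this, ← γ.l_eq_k hX1]
    push_cast
    ring
  rw [HasPeriod, ← e]
  exact h4

theorem symm (hX1 : (X : MU d).1 = 1) (hz : HasPeriod h γ z) : HasPeriod h γ.symm (-z) := by
  have := HasIncrement.symm hz
  have e : (γ.symm.l : ℂ) * (-z) = -(γ.l * z) := by
    have : γ.symm.l = γ.k := rfl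
    rw [this, ← γ.l_eq_k hX1]
    ring
  rw [HasPeriod, e]
  exact this

theorem iter (hX1 : (X : MU d).1 = 1) (hD : IsFreeSet D) (hDo : ∀ n, IsOpen (slice D n))
    (hh : h ∈ closedMaps D) (hz : HasPeriod h γ z) (n : ℕ) :
    HasPeriod h (γ.iter hD n) (n * z) := by
  induction n with
  | zero =>
    rw [Nat.cast_zero, zero_mul]
    exact refl hDo hh
  | succ n ih =>
    have := comp hX1 hD hDo hh hz ih
    rwa [show z + n * z = ((n + 1 : ℕ) : ℂ) * z by push_cast; ring] at this

/-- The value of a tracial primitive continued along a loop. -/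
theorem eval_eq (hX1 : (X : MU d).1 = 1) (hDo : ∀ n, IsOpen (slice D n))
    (hh : h ∈ closedMaps D) {B : Set (MU d)} (hB : IsFreeSet B) (hXB : (X : MU d) ∈ B)
    {f : MU d → ℂ} (hf : IsTracial B f) (hfh : ∀ x ∈ B, IsLocalPrimitive h f x)
    (hz : HasPeriod h γ z) : γ.eval f = f X + z := by
  have hl : (γ.l : ℂ) ≠ 0 := Nat.cast_ne_zero.2 γ.l_pos.ne'
  rw [EssPath.eval, HasIncrement.continuedValue_eq hDo hh γ.mem
    (hfh _ (nsmul_mem hB hXB γ.k_pos)) hz, hf.map_nsmul hB hXB γ.k_pos, ← γ.l_eq_k hX1]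
  field_simp

/-- Testing trace equivalence on the primitive f, with the trivial path as γ₃, recovers the period.
-/
theorem congr_of_mk_eq (hX1 : (X : MU d).1 = 1) (hD : IsFreeSet D)
    (hDo : ∀ n, IsOpen (slice D n)) (hh : h ∈ closedMaps D) {B : Set (MU d)} (hB : IsFreeSet B)
    (hXB : (X : MU d) ∈ B) {f : MU d → ℂ} (hf : IsTracial B f)
    (hfh : ∀ x ∈ B, IsLocalPrimitive h f x) (hγ : Pi1tr.mk hD B γ = Pi1tr.mk hD B γ')
    (hz : HasPeriod h γ z) : HasPeriod h γ' z := by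
  obtain ⟨w, hw⟩ := exists_of_closed hDo hh γ'
  have := Quotient.exact (s := traceSetoid hD B X X) hγ f (hf.isGlobalGerm hDo hh hfh) X
    (EssPath.refl X)
  rw [eval_eq hX1 hDo hh hB hXB hf hfh (comp hX1 hD hDo hh (refl hDo hh) hz),
    eval_eq hX1 hDo hh hB hXB hf hfh (comp hX1 hD hDo hh (refl hDo hh) hw)] at this
  have e : z = w := by linear_combination this
  rwa [e]

/-- If increments along loops are integral, so are the periods of integral loops. -/
theorem exists_int_of_isIntegralLoop (hX1 : (X : MU d).1 = 1) (hD : IsFreeSet D)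
    (hDo : ∀ n, IsOpen (slice D n)) (hh : h ∈ closedMaps D) {B : Set (MU d)} (hB : IsFreeSet B)
    (hXB : (X : MU d) ∈ B) {f : MU d → ℂ} (hf : IsTracial B f)
    (hfh : ∀ x ∈ B, IsLocalPrimitive h f x)
    (hint : ∀ (γ : EssPath D X X) (v : ℂ), HasIncrement h γ.path v → ∃ k : ℤ, v = k)
    (hγ : IsIntegralLoop hD B X γ) : ∃ k : ℤ, HasPeriod h γ k := by
  induction hγ with
  | refl => exact ⟨0, by simpa using refl hDo hh⟩
  | gen n hn γ hγ =>
    obtain ⟨γ', hγ', hmk⟩ := hγ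
    obtain ⟨z, hz⟩ := exists_of_closed hDo hh γ'
    obtain ⟨k, hk⟩ := hint γ' _ hz
    -- The representative inside D_n has multiplicity n, so its integral increment is n * z, which
    -- is the period of the n-fold product.
    have hl : γ'.l = n := by
      have := hγ' 1
      rwa [γ'.path.target, size_nsmul, hX1, mul_one] at this
    refine ⟨k, ?_⟩
    rw [← hk, hl]
    exact iter hX1 hD hDo hh (congr_of_mk_eq hX1 hD hDo hh hB hXB hf hfh hmk hz) n
  | comp γ₂ γ₁ _ _ ih₂ ih₁ =>
    obtain ⟨k₂, h₂⟩ := ih₂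
    obtain ⟨k₁, h₁⟩ := ih₁
    exact ⟨k₂ + k₁, by simpa using comp hX1 hD hDo hh h₂ h₁⟩
  | symm γ _ ih =>
    obtain ⟨k, hk⟩ := ih
    exact ⟨-k, by simpa using symm hX1 hk⟩

end HasPeriod

/-! ### Gradients, divisors and local primitives -/

section forms
variable {E : Type*} [NormedAddCommGroup E] [NormedSpace ℂ E]

/-- A complex function whose real derivative is complex linear is complex differentiable. -/
theorem nhasFDerivAt_of_fderiv_real [NormedSpace ℝ E] [IsScalarTower ℝ ℂ E] {f : E → ℂ} {x : E}
    {L : NLin E ℂ} (hf : DifferentiableAt ℝ f x) (hL : ∀ H, fderiv ℝ f x H = L H) :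
    NHasFDerivAt f L x :=
  hasFDerivAt_of_restrictScalars ℝ hf.hasFDerivAt (ContinuousLinearMap.ext fun H => (hL H).symm)

theorem NHasFDerivAt.differentiableAt_real [NormedSpace ℝ E] [IsScalarTower ℝ ℂ E] {f : E → ℂ}
    {x : E} {L : NLin E ℂ} (hf : NHasFDerivAt f L x) :
    DifferentiableAt ℝ f x ∧ ∀ H, fderiv ℝ f x H = L H := by
  have := HasFDerivAt.restrictScalars ℝ hf
  exact ⟨this.differentiableAt, fun H => by rw [this.fderiv]; rfl⟩

/-- A local branch of the logarithm of a function is a primitive of its logarithmic derivative. -/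
theorem exists_log_primitive {ω : E → NLin E ℂ} {f : E → ℂ} {x : E} (hx : f x ≠ 0)
    (hf : ∀ᶠ y in 𝓝 x, NHasFDerivAt f (f y • ω y) y) :
    ∃ P : E → ℂ, (∀ᶠ y in 𝓝 x, NHasFDerivAt P (ω y) y) ∧
      ∀ᶠ y in 𝓝 x, f y = f x * Complex.exp (P y) := by
  -- Dividing by f x moves the value at x to 1, inside the domain of the principal logarithm.
  have hc : ContinuousAt (fun y => f y / f x) x :=
    (HasFDerivAt.continuousAt hf.self_of_nhds).div_const _
  have hs : ∀ᶠ y in 𝓝 x, f y / f x ∈ Complex.slitPlane :=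
    hc.eventually (Complex.isOpen_slitPlane.mem_nhds (by
      change f x / f x ∈ _
      rw [div_self hx]
      exact Complex.one_mem_slitPlane))
  refine ⟨fun y => Complex.log (f y / f x), ?_, ?_⟩
  · filter_upwards [hf, hs] with y hy hys
    have hy0 : f y ≠ 0 := fun h0 => Complex.slitPlane_ne_zero hys (by simp [h0])
    have h1 : HasFDerivAt (fun y => f y / f x) ((f x)⁻¹ • (f y • ω y)) y := by
      simpa [div_eq_inv_mul] using HasFDerivAt.const_mul hy (f x)⁻¹
    refine (h1.clog hys).congr_fderiv ?_
    refine ContinuousLinearMap.ext fun H => ?_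
    simp only [smul_apply, smul_eq_mul]
    field_simp
  · filter_upwards [hs] with y hy
    rw [Complex.exp_log (Complex.slitPlane_ne_zero hy), mul_div_cancel₀ _ hx]

/-- The derivative of a differentiable one-form with a primitive is symmetric. -/
theorem fderiv_symm_of_primitive {ω : E → NLin E ℂ} {P : E → ℂ} {x : E}
    (hP : ∀ᶠ y in 𝓝 x, NHasFDerivAt P (ω y) y) (hω : DifferentiableAt ℂ ω x) (H K : E) :
    fderiv ℂ ω x H K = fderiv ℂ ω x K H :=
  second_derivative_symmetric_of_eventually hP hω.hasFDerivAt H K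

theorem nhasFDerivAt_exp {ω : E → NLin E ℂ} {f P : E → ℂ} {x : E} {b c : ℂ}
    (hP : NHasFDerivAt P (ω x) x) (hf : ∀ᶠ y in 𝓝 x, f y = b * Complex.exp (c * P y)) :
    NHasFDerivAt f (f x • c • ω x) x := by
  have h1 := ((HasFDerivAt.const_mul hP c).cexp.const_mul b).congr_of_eventuallyEq hf
  refine h1.congr_fderiv (ContinuousLinearMap.ext fun H => ?_)
  rw [hf.self_of_nhds]
  simp only [smul_apply, smul_eq_mul]
  ring

theorem contDiffAt_real_exp [NormedSpace ℝ E] [IsScalarTower ℝ ℂ E] {f P : E → ℂ} {x : E}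
    {b c : ℂ} (hP : AnalyticAt ℂ P x) (hf : ∀ᶠ y in 𝓝 x, f y = b * Complex.exp (c * P y)) :
    ContDiffAt ℝ 1 f x := by
  have h1 : ContDiffAt ℂ 1 P x := hP.contDiffAt
  have h2 : ContDiffAt ℂ 1 f x :=
    ((contDiffAt_const.mul (contDiffAt_const.mul h1).cexp)).congr_of_eventuallyEq hf
  exact h2.restrict_scalars ℝ

theorem eventually_exists_path {x : E} {p : E → Prop} (hp : ∀ᶠ y in 𝓝 x, p y) :
    ∀ᶠ y in 𝓝 x, ∃ γ : Path x y, ∀ t, p (γ t) := by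
  let : NormedSpace ℝ E := NormedSpace.restrictScalars ℝ ℂ E
  obtain ⟨δ, hδ, h⟩ := Metric.eventually_nhds_iff_ball.1 hp
  filter_upwards [Metric.ball_mem_nhds x hδ] with y hy
  have := ((convex_ball x δ).isPathConnected ⟨x, Metric.mem_ball_self hδ⟩).joinedIn x
    (Metric.mem_ball_self hδ) y hy
  exact ⟨this.somePath, fun t => h _ (this.somePath_mem t)⟩

theorem joinedIn_of_isPreconnected {s : Set E} (hs : IsOpen s) (hc : IsPreconnected s) {x y : E}
    (hx : x ∈ s) (hy : y ∈ s) : JoinedIn s x y := by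
  let : NormedSpace ℝ E := NormedSpace.restrictScalars ℝ ℂ E
  exact (hs.isConnected_iff_isPathConnected.1 ⟨⟨x, hx⟩, hc⟩).joinedIn x hx y hy

end forms

/-! ### Translation of gradients and divisors into complex derivatives -/

theorem HasFreeGradient.isLocalPrimitive {d : ℕ} {D : Set (MU d)} (hDo : ∀ n, IsOpen (slice D n))
    {f : MU d → ℂ} {h : GradedMap d} (hf : HasFreeGradient D f h) {x : MU d} (hx : x ∈ D) :
    IsLocalPrimitive h f x := by
  filter_upwards [mem_nhds_of_mem hDo hx] with y hy
  exact nhasFDerivAt_of_fderiv_real (hf y.1 y.2 hy).1 (hf y.1 y.2 hy).2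

theorem hasFreeGradient_of_isLocalPrimitive {d : ℕ} {D : Set (MU d)} {f : MU d → ℂ}
    {h : GradedMap d} (hf : ∀ x ∈ D, IsLocalPrimitive h f x) : HasFreeGradient D f h :=
  fun n X hX => NHasFDerivAt.differentiableAt_real (hf ⟨n, X⟩ hX).self_of_nhds

theorem HasDivisor.nhasFDerivAt {d : ℕ} {D : Set (MU d)} {f : MU d → ℂ} {g : GradedMap d}
    (hf : HasDivisor D f g) (hf0 : ∀ Y ∈ D, f Y ≠ 0) {n : ℕ} {X : Tup d n} (hX : X ∈ slice D n) :
    NHasFDerivAt (fun Y : Tup d n => f ⟨n, Y⟩) (f ⟨n, X⟩ • form (g n X)) X := by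
  obtain ⟨h1, h2⟩ := hf n X hX (hf0 _ hX)
  refine nhasFDerivAt_of_fderiv_real h1 fun H => ?_
  have := h2 H
  change _ = f ⟨n, X⟩ * pairing H (g n X)
  rw [← this, mul_inv_cancel_left₀ (hf0 _ hX)]
  rfl

/-! ### Divisors have integral classes -/

theorem two_pi_I_mul_inv : 2 * (Real.pi : ℂ) * Complex.I * (1 / (2 * (Real.pi : ℂ) * Complex.I)) = 1 :=
  mul_one_div_cancel Complex.two_pi_I_ne_zero

/-- The one-form of g is the derivative of a local branch of log f, and second derivatives are
symmetric. -/
theorem mem_closedMaps_of_hasDivisor {d : ℕ} {D : Set (MU d)} (hDo : ∀ n, IsOpen (slice D n))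
    {g : GradedMap d} (hg : IsAnalyticFreeMap D g) {f : MU d → ℂ} (hf0 : ∀ Y ∈ D, f Y ≠ 0)
    (hf : HasDivisor D f g) : g ∈ closedMaps D := by
  refine ⟨hg, fun n X hX H K => ?_⟩
  obtain ⟨P, hP, -⟩ := exists_log_primitive (ω := fun Y => form (g n Y))
    (f := fun Y : Tup d n => f ⟨n, Y⟩) (x := X) (hf0 _ hX) (by
      filter_upwards [(hDo n).mem_nhds hX] with Y hY using hf.nhasFDerivAt hf0 hY)
  have hs := fderiv_symm_of_primitive hP (analyticAt_form hg hX).differentiableAt H K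
  have hd : NHasFDerivAt (g n) (fderiv ℂ (g n) X) X :=
    (hg.analytic n X hX).differentiableAt.hasFDerivAt
  have e := (HasFDerivAt.comp X (ContinuousLinearMap.hasFDerivAt (form (d := d) (n := n))) hd).fderiv
  exact (DFunLike.congr_fun (DFunLike.congr_fun e H) K).symm.trans
    (hs.trans (DFunLike.congr_fun (DFunLike.congr_fun e K) H))

theorem exists_isLocalPrimitive_log {d : ℕ} {D : Set (MU d)} (hDo : ∀ n, IsOpen (slice D n))
    {g : GradedMap d} {f : MU d → ℂ} (hf0 : ∀ Y ∈ D, f Y ≠ 0)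
    (hf : HasDivisor D f g) {x : MU d} (hx : x ∈ D) :
    ∃ P, IsLocalPrimitive ((1 / (2 * (Real.pi : ℂ) * Complex.I)) • g) P x ∧
      ∀ᶠ y in 𝓝 x, f y = f x * Complex.exp (2 * Real.pi * Complex.I * P y) := by
  obtain ⟨n, X⟩ := x
  obtain ⟨P, hP, hP'⟩ := exists_log_primitive (ω := fun Y => form (g n Y))
    (f := fun Y : Tup d n => f ⟨n, Y⟩) (x := X) (hf0 _ hx) (by
      filter_upwards [(hDo n).mem_nhds hx] with Y hY using hf.nhasFDerivAt hf0 hY)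
  refine ⟨fun y => if e : y.1 = n then (1 / (2 * (Real.pi : ℂ) * Complex.I)) * P (e ▸ y.2) else 0,
    isLocalPrimitive_mk.2 ?_, eventually_nhds_mk.2 ?_⟩
  · simp only [dite_true]
    filter_upwards [hP] with Y hY
    refine (HasFDerivAt.const_mul hY _).congr_fderiv (ContinuousLinearMap.ext fun H => ?_)
    exact (pairing_smul _ H (g n Y)).symm
  · simp only [dite_true]
    filter_upwards [hP'] with Y hY
    rw [hY, ← mul_assoc (2 * (Real.pi : ℂ) * Complex.I), two_pi_I_mul_inv, one_mul]

/-- Up to a constant Φ is locally log f/(2πi), so f(γ) exp(-2πiΦ) is constant along γ. As f has the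
same nonzero value at both ends, exp(2πiΦ) does too. -/
theorem exists_int_of_hasDivisor {d : ℕ} {D : Set (MU d)} (hDo : ∀ n, IsOpen (slice D n))
    {g : GradedMap d} {f : MU d → ℂ} (hf0 : ∀ Y ∈ D, f Y ≠ 0) (hf : HasDivisor D f g)
    {x y : MU d} (hxy : x = y) {γ : Path x y} (hγ : ∀ t, γ t ∈ D) {v : ℂ}
    (hv : HasIncrement ((1 / (2 * (Real.pi : ℂ) * Complex.I)) • g) γ v) : ∃ k : ℤ, v = k := by
  obtain ⟨Φ, hΦ, rfl⟩ := hv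
  have hl : IsLocallyConstant fun t =>
      f (γ t) * Complex.exp (-(2 * Real.pi * Complex.I * Φ t)) := by
    have key : ∀ t, ∃ c : ℂ, ∀ᶠ s in 𝓝 t,
        f (γ s) * Complex.exp (-(2 * Real.pi * Complex.I * Φ s)) = c := by
      intro t
      obtain ⟨P, hP, hP'⟩ := exists_isLocalPrimitive_log hDo hf0 hf (hγ t)
      obtain ⟨Q, hQ, hQ'⟩ := hΦ t
      refine ⟨f (γ t) * Complex.exp (2 * Real.pi * Complex.I * (P (γ t) - Q (γ t))), ?_⟩
      filter_upwards [γ.continuous.continuousAt.eventually hP', hQ',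
        γ.continuous.continuousAt.eventually (hP.eventually_sub_eq hQ)] with s h1 h2 h3
      rw [h1, h2, mul_assoc, ← Complex.exp_add]
      congr 2
      linear_combination (2 * Real.pi * Complex.I) * h3
    refine (IsLocallyConstant.iff_eventually_eq _).2 fun t => ?_
    obtain ⟨c, hc⟩ := key t
    filter_upwards [hc] with s hs
    rw [hs, hc.self_of_nhds]
  have h1 := hl.apply_eq_of_preconnectedSpace 1 0
  simp only [γ.source, γ.target, hxy] at h1
  have h2 := mul_left_cancel₀ (hf0 y (by simpa using hγ 1)) h1
  obtain ⟨k, hk⟩ := Complex.exp_eq_exp_iff_exists_int.1 h2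
  refine ⟨-k, mul_left_cancel₀ Complex.two_pi_I_ne_zero ?_⟩
  push_cast
  linear_combination -hk

/-! ### Change of representative -/

theorem IsLocalPrimitive.add {d : ℕ} {g h : GradedMap d} {P Q : MU d → ℂ} {x : MU d}
    (hP : IsLocalPrimitive g P x) (hQ : IsLocalPrimitive h Q x) :
    IsLocalPrimitive (g + h) (fun y => P y + Q y) x := by
  filter_upwards [hP, hQ] with y h1 h2
  refine (HasFDerivAt.add h1 h2).congr_fderiv (ContinuousLinearMap.ext fun H => ?_)
  exact (pairing_add H (g y.1 y.2) (h y.1 y.2)).symm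

theorem HasIncrement.add_of_isLocalPrimitive {d : ℕ} {g h : GradedMap d} {x y : MU d}
    {γ : Path x y} {v : ℂ} (hγ : HasIncrement g γ v) {P : MU d → ℂ}
    (hP : ∀ t, IsLocalPrimitive h P (γ t)) : HasIncrement (g + h) γ (v + (P y - P x)) := by
  obtain ⟨Φ, hΦ, rfl⟩ := hγ
  refine ⟨fun t => Φ t + P (γ t), fun t => ?_, by simp; ring⟩
  obtain ⟨Q, hQ, hQ'⟩ := hΦ t
  exact ⟨_, hQ.add (hP t), hQ'.mono fun s hs => congrArg (· + P (γ s)) hs⟩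

/-- A potential of h - g defined on all of D takes equal values at the ends of a loop, because k =
l, and so adds nothing to the increment. -/
theorem HasPeriod.congr_of_exact {d : ℕ} {D : Set (MU d)} (hDo : ∀ n, IsOpen (slice D n))
    {g h : GradedMap d} (hgh : h - g ∈ exactMaps D) {X : D} (hX1 : (X : MU d).1 = 1)
    {γ : EssPath D X X} {z : ℂ} (hz : HasPeriod g γ z) : HasPeriod h γ z := by
  obtain ⟨-, f, -, hf⟩ := hgh
  have := HasIncrement.add_of_isLocalPrimitive hz fun t => hf.isLocalPrimitive hDo (γ.mem t)
  have e : f (γ.l • (X : MU d)) = f (γ.k • (X : MU d)) := by rw [γ.l_eq_k hX1]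
  rwa [add_sub_cancel, e, sub_self, add_zero] at this

/-- `IsPeriod` allows any representative of the class and any germ. Both choices drop out, so
integrality becomes a statement about increments of h itself. -/
theorem IsPeriod.hasPeriod {d : ℕ} {D B : Set (MU d)} (hDo : ∀ n, IsOpen (slice D n))
    (hB : IsFreeSet B) (hBo : ∀ n, IsOpen (slice B n)) {X : D} (hXB : (X : MU d) ∈ B)
    (hX1 : (X : MU d).1 = 1) {h : closedMaps D} {γ : EssPath D X X} {z : ℂ}
    (hz : IsPeriod B X (Submodule.Quotient.mk h) γ z) : HasPeriod (h : GradedMap d) γ z := by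
  obtain ⟨g, f, hgh, hf, hfg, rfl⟩ := hz
  have hgh' : (h : GradedMap d) - g ∈ exactMaps D :=
    (Submodule.Quotient.eq ((exactMaps D).submoduleOf (closedMaps D))).1 hgh.symm
  have hfg' : ∀ x ∈ B, IsLocalPrimitive (g : GradedMap d) f x :=
    fun x hx => hfg.isLocalPrimitive hBo hx
  obtain ⟨w, hw⟩ := HasPeriod.exists_of_closed hDo g.2 γ
  refine HasPeriod.congr_of_exact hDo hgh' hX1 ?_
  rw [hw.eval_eq hX1 hDo g.2 hB hXB hf.tracial hfg',
    (HasPeriod.refl hDo g.2).eval_eq hX1 hDo g.2 hB hXB hf.tracial hfg', hX1]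
  simpa using hw

/-! ### The determinantal function of an integral class -/

/-- `v` is the increment of primitives of `h` along a path in `D_n` from the scalar tuple `a`
to `Y`. -/
def Reaches {d : ℕ} (D : Set (MU d)) (h : GradedMap d) (a : Fin d → ℂ) {n : ℕ} (Y : Tup d n)
    (v : ℂ) : Prop :=
  ∃ γ : Path (scalarTup a n) Y, (∀ t, γ t ∈ slice D n) ∧
    HasIncrement h (γ.map (continuous_sigmaMk (σ := Tup d))) v

theorem blockSum_scalarTup {d : ℕ} (a : Fin d → ℂ) (n m : ℕ) :
    blockSum (scalarTup a n) (scalarTup a m) = scalarTup a (n + m) := by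
  have h := nsmul_scalarTup a (n + m)
  rw [add_nsmul, nsmul_scalarTup, nsmul_scalarTup, mk_add_mk] at h
  exact eq_of_heq (Sigma.mk.inj h).2

namespace Reaches
variable {d : ℕ} {D : Set (MU d)} {h : GradedMap d} {a : Fin d → ℂ} {n m : ℕ} {Y : Tup d n}
  {Z : Tup d m} {v w : ℂ}

theorem exists_of_mem (hDo : ∀ n, IsOpen (slice D n)) (hDc : ∀ n, IsPreconnected (slice D n))
    (hh : h ∈ closedMaps D) (ha : scalarTup a n ∈ slice D n) (hY : Y ∈ slice D n) :
    ∃ v, Reaches D h a Y v := by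
  have hJ : JoinedIn (slice D n) (scalarTup a n) Y :=
    joinedIn_of_isPreconnected (hDo n) (hDc n) ha hY
  obtain ⟨v, hv⟩ := HasIncrement.exists_of_closed hDo hh
    (hJ.somePath.map (continuous_sigmaMk (σ := Tup d))) fun t => hJ.somePath_mem t
  exact ⟨v, hJ.somePath, hJ.somePath_mem, hv⟩

theorem add (hD : IsFreeSet D) (hDo : ∀ n, IsOpen (slice D n)) (hh : h ∈ closedMaps D)
    (hv : Reaches D h a Y v) (hw : Reaches D h a Z w) :
    Reaches D h a (blockSum Y Z) (v + w) := by
  obtain ⟨γ, hγ, Φ, hΦ, rfl⟩ := hv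
  obtain ⟨η, hη, Ψ, hΨ, rfl⟩ := hw
  refine ⟨((γ.prod η).map continuous_blockSum).cast (blockSum_scalarTup a n m).symm rfl,
    fun t => hD.add_mem _ (hγ t) _ (hη t), fun t => Φ t + Ψ t, ?_, by ring⟩
  exact IsPrimitiveAlong.add hD hDo hh (Path.continuous _) (Path.continuous _) hγ hη hΦ hΨ

/-- Conjugation fixes the scalar starting point, so the conjugated path is again admissible, with
the same increment. -/
theorem conj (hD : IsFreeSet D) (hDo : ∀ n, IsOpen (slice D n)) (hh : h ∈ closedMaps D)
    (U : Matrix.unitaryGroup (Fin n) ℂ) (hv : Reaches D h a Y v) :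
    Reaches D h a (FreeDivisor.conj U Y) v := by
  obtain ⟨γ, hγ, Φ, hΦ, rfl⟩ := hv
  have hU : Continuous (FreeDivisor.conj U : Tup d n → Tup d n) := (conjL U).continuous
  exact ⟨(γ.map hU).cast (conj_scalarTup a U).symm rfl, fun t => hD.conj_mem _ _ U (hγ t), Φ,
    IsPrimitiveAlong.conj hD hDo hh U γ.continuous hγ hΦ, rfl⟩

/-- The path is prolonged by a short one along which P is a primitive. -/
theorem eventually (hDo : ∀ n, IsOpen (slice D n)) (hh : h ∈ closedMaps D)
    (hY : Y ∈ slice D n) (hv : Reaches D h a Y v) {P : MU d → ℂ}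
    (hP : IsLocalPrimitive h P ⟨n, Y⟩) :
    ∀ᶠ Y' in 𝓝 Y, Reaches D h a Y' (v + (P ⟨n, Y'⟩ - P ⟨n, Y⟩)) := by
  obtain ⟨γ, hγ, hv⟩ := hv
  have hev : ∀ᶠ Y' in 𝓝 Y, Y' ∈ slice D n ∧ IsLocalPrimitive h P ⟨n, Y'⟩ :=
    Eventually.and ((hDo n).mem_nhds hY) (eventually_nhds_mk.1 hP.eventually_nhds)
  have hpath : ∀ᶠ Y' in 𝓝 Y, ∃ η : Path Y Y', ∀ t, η t ∈ slice D n ∧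
      IsLocalPrimitive h P ⟨n, η t⟩ := eventually_exists_path hev
  filter_upwards [hpath] with Y' hY'
  obtain ⟨η, hη⟩ := hY'
  refine ⟨γ.trans η, fun t => ?_, ?_⟩
  · rw [Path.trans_apply]
    split_ifs
    · exact hγ _
    · exact (hη _).1
  · rw [Path.map_trans]
    exact HasIncrement.trans hDo hh (fun t => hγ t) (fun t => (hη t).1) hv
      (HasIncrement.of_isLocalPrimitive fun t => (hη t).2)

/-- Two paths to Y close up to a loop θ at n•X inside D_n, of multiplicity n and period (v - w)/n.
Its n-fold product is an integral loop by definition and has period v - w. -/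
theorem sub_eq_int (hD : IsFreeSet D) (hDo : ∀ n, IsOpen (slice D n)) (hh : h ∈ closedMaps D)
    {B : Set (MU d)} (hB : IsFreeSet B) (hBo : ∀ n, IsOpen (slice B n)) {X : D}
    (hX : (X : MU d) = ⟨1, scalarTup a 1⟩) (hXB : (X : MU d) ∈ B) (hn : 0 < n)
    (hint : (Submodule.Quotient.mk ⟨h, hh⟩ : H1tr D) ∈ H1trInt hD B X)
    (hv : Reaches D h a Y v) (hw : Reaches D h a Y w) : ∃ k : ℤ, v - w = k := by
  have hX1 : (X : MU d).1 = 1 := by rw [hX]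
  obtain ⟨γ, hγ, hv⟩ := hv
  obtain ⟨η, hη, hw⟩ := hw
  have hnX : n • (X : MU d) = ⟨n, scalarTup a n⟩ := by rw [hX, nsmul_scalarTup]
  have hmem : ∀ t, (γ.trans η.symm) t ∈ slice D n := fun t => by
    rw [Path.trans_apply]
    split_ifs
    · exact hγ _
    · exact hη _
  have hinc : HasIncrement h ((γ.trans η.symm).map (continuous_sigmaMk (σ := Tup d)))
      (v - w) := by
    rw [Path.map_trans, sub_eq_add_neg]
    exact HasIncrement.trans hDo hh (fun t => hγ t) (fun t => hη _) hv hw.symm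
  let θ : EssPath D X X := ⟨n, n, hn, hn,
    ((γ.trans η.symm).map (continuous_sigmaMk (σ := Tup d))).cast hnX hnX, hmem⟩
  have hθ : HasPeriod h θ ((n : ℂ)⁻¹ * (v - w)) := by
    change HasIncrement h θ.path ((n : ℂ) * ((n : ℂ)⁻¹ * (v - w)))
    rw [mul_inv_cancel_left₀ (Nat.cast_ne_zero.2 hn.ne')]
    exact hinc
  have hloop : IsIntegralLoop hD B X (θ.iter hD n) := .gen n hn θ ⟨θ, fun _ => rfl, rfl⟩
  obtain ⟨k, hk⟩ := hint _ ⟨_, hloop, rfl⟩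
  refine ⟨k, ?_⟩
  have := (hk.hasPeriod hDo hB hBo hXB hX1).unique (hθ.iter hX1 hD hDo hh n)
  rw [this, mul_inv_cancel_left₀ (Nat.cast_ne_zero.2 hn.ne')]

end Reaches

theorem exists_isDeterminantal_of_integral {d : ℕ} {D B : Set (MU d)} (hD : IsFreeSet D)
    (hDo : ∀ n, IsOpen (slice D n)) (hDc : ∀ n, IsPreconnected (slice D n))
    (hB : IsFreeSet B) (hBo : ∀ n, IsOpen (slice B n)) {X : D} (hXB : (X : MU d) ∈ B)
    (hX1 : (X : MU d).1 = 1) {g h : GradedMap d} (hgh : g = (2 * (Real.pi : ℂ) * Complex.I) • h)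
    (hh : h ∈ closedMaps D)
    (hint : (Submodule.Quotient.mk ⟨h, hh⟩ : H1tr D) ∈ H1trInt hD B X) :
    ∃ f : MU d → ℂ, IsDeterminantal D f ∧ IsC1 D f ∧ (∀ Y ∈ D, f Y ≠ 0) ∧ HasDivisor D f g := by
  obtain ⟨a, ha⟩ := exists_eq_scalarTup hX1
  have hscal : ∀ n, 0 < n → scalarTup a n ∈ slice D n := fun n hn => by
    have := nsmul_mem hD X.2 hn
    rwa [ha, nsmul_scalarTup] at this
  have hex : ∀ Y : MU d, ∃ v, Y ∈ D → Reaches D h a Y.2 v := fun Y => by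
    by_cases hY : Y ∈ D
    · obtain ⟨v, hv⟩ := Reaches.exists_of_mem hDo hDc hh (hscal _ (hD.size_pos _ hY)) hY
      exact ⟨v, fun _ => hv⟩
    · exact ⟨0, fun hY' => absurd hY' hY⟩
  -- V is an arbitrary choice without any continuity; only its class modulo ℤ matters.
  choose V hV using hex
  let f : MU d → ℂ := fun Y => Complex.exp (2 * Real.pi * Complex.I * V Y)
  have hf : ∀ {n : ℕ} {Y : Tup d n} {v : ℂ}, Y ∈ slice D n → Reaches D h a Y v →
      f ⟨n, Y⟩ = Complex.exp (2 * Real.pi * Complex.I * v) := by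
    intro n Y v hY hv
    obtain ⟨k, hk⟩ := Reaches.sub_eq_int hD hDo hh hB hBo ha hXB (hD.size_pos _ hY) hint
      (hV _ hY) hv
    refine Complex.exp_eq_exp_iff_exists_int.2 ⟨k, ?_⟩
    linear_combination (2 * Real.pi * Complex.I) * hk
  -- Near Y, modulo ℤ, V is a local primitive P plus a constant, so f inherits regularity and
  -- derivative from P.
  have hloc : ∀ {n : ℕ} {Y : Tup d n}, Y ∈ slice D n → ∃ P : MU d → ℂ, ∃ b : ℂ,
      IsLocalPrimitive h P ⟨n, Y⟩ ∧ ∀ᶠ Y' in 𝓝 Y,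
        f ⟨n, Y'⟩ = b * Complex.exp (2 * Real.pi * Complex.I * P ⟨n, Y'⟩) := by
    intro n Y hY
    obtain ⟨P, hP⟩ := exists_isLocalPrimitive hDo hh hY
    refine ⟨P, Complex.exp (2 * Real.pi * Complex.I * (V ⟨n, Y⟩ - P ⟨n, Y⟩)), hP, ?_⟩
    filter_upwards [(hV _ hY).eventually hDo hh hY hP, (hDo n).mem_nhds hY] with Y' h1 h2
    rw [hf h2 h1, ← Complex.exp_add]
    congr 1
    ring
  have hf0 : ∀ Y, f Y ≠ 0 := fun Y => Complex.exp_ne_zero _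
  refine ⟨f, ⟨?_, ?_⟩, ?_, fun Y _ => hf0 Y, ?_⟩
  · rintro ⟨n, Y⟩ hY ⟨m, Z⟩ hZ
    have := hf (hD.add_mem _ hY _ hZ) (Reaches.add hD hDo hh (hV _ hY) (hV _ hZ))
    rw [mk_add_mk, this, mul_add, Complex.exp_add]
  · intro n Y U hY
    exact hf (hD.conj_mem n Y U hY) (Reaches.conj hD hDo hh U (hV _ hY))
  · intro n Y hY
    obtain ⟨P, b, hP, hPf⟩ := hloc hY
    exact (contDiffAt_real_exp (hP.analyticAt hh.1 hY) hPf).contDiffWithinAt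
  · intro n Y hY _
    obtain ⟨P, b, hP, hPf⟩ := hloc hY
    have hd := nhasFDerivAt_exp (ω := fun Y => form (h n Y)) (isLocalPrimitive_mk.1 hP).self_of_nhds
      hPf
    obtain ⟨h1, h2⟩ := NHasFDerivAt.differentiableAt_real hd
    refine ⟨h1, fun H => ?_⟩
    have e := h2 H
    change _ = f ⟨n, Y⟩ * (2 * Real.pi * Complex.I * pairing H (h n Y)) at e
    have e' : pairing H (g n Y) = 2 * Real.pi * Complex.I * pairing H (h n Y) := by
      rw [hgh]
      exact pairing_smul _ H (h n Y)
    rw [e', ← inv_mul_cancel_left₀ (hf0 ⟨n, Y⟩) (2 * Real.pi * Complex.I * pairing H (h n Y)), ← e]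
    rfl

/-- A free map is the divisor of a determinantal function without zeros if and only if it is, up to
the factor `2πi`, a closed free map with integral class. -/
theorem exists_isDeterminantal_iff {d : ℕ} (D B : Set (MU d)) (hD : IsAnchored D)
    (hB : IsAnchor D B) (X : D) (hXB : (X : MU d) ∈ B) (hX1 : (X : MU d).1 = 1)
    (g : GradedMap d) (hg : IsAnalyticFreeMap D g) :
    (∃ f : MU d → ℂ, IsDeterminantal D f ∧ IsC1 D f ∧ (∀ Y ∈ D, f Y ≠ 0) ∧ HasDivisor D f g) ↔
      ∃ hcl : (1 / (2 * (Real.pi : ℂ) * Complex.I)) • g ∈ closedMaps D,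
        (Submodule.Quotient.mk ⟨(1 / (2 * (Real.pi : ℂ) * Complex.I)) • g, hcl⟩ : H1tr D) ∈
          H1trInt hD.free B X := by
  have hDo := hD.isOpen
  constructor
  · rintro ⟨f, -, -, hf0, hf⟩
    have hcl : (1 / (2 * (Real.pi : ℂ) * Complex.I)) • g ∈ closedMaps D :=
      (closedMaps D).smul_mem _ (mem_closedMaps_of_hasDivisor hDo hg hf0 hf)
    refine ⟨hcl, ?_⟩
    -- A germ with gradient h is needed twice: to compare trace equivalent loops and to witness
    -- `IsPeriod`.
    obtain ⟨F, hF, hFh⟩ := exists_isTracial_isLocalPrimitive hB.free hB.isOpen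
      hB.simplyConnected (closedMaps_anti hB.subset hcl) hXB hX1
    rintro γ ⟨γ', hγ', hmk⟩
    obtain ⟨k, hk⟩ := HasPeriod.exists_int_of_isIntegralLoop hX1 hD.free hDo hcl hB.free hXB hF hFh
      (fun η v hv => exists_int_of_hasDivisor hDo hf0 hf
        (congrArg (· • (X : MU d)) (η.l_eq_k hX1).symm) η.mem hv) hγ'
    have hkγ := hk.congr_of_mk_eq hX1 hD.free hDo hcl hB.free hXB hF hFh hmk
    refine ⟨k, ⟨_, hcl⟩, F, rfl, hF.isGlobalGerm hDo hcl hFh,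
      hasFreeGradient_of_isLocalPrimitive hFh, ?_⟩
    rw [hkγ.eval_eq hX1 hDo hcl hB.free hXB hF hFh,
      (HasPeriod.refl hDo hcl).eval_eq hX1 hDo hcl hB.free hXB hF hFh, hX1]
    simp
  · rintro ⟨hcl, hint⟩
    refine exists_isDeterminantal_of_integral hD.free hDo hD.connected hB.free hB.isOpen hXB hX1
      ?_ hcl hint
    rw [smul_smul, two_pi_I_mul_inv, one_smul]

end FreeDivisor

theorem mainTheorem3 {d : ℕ} (D B : Set (FreeDivisor.MU d)) (hD : FreeDivisor.IsAnchored D)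
    (hDn : ∀ n, 0 < n → (FreeDivisor.slice D n).Nonempty)
    (hB : FreeDivisor.IsAnchor D B)
    (hBn : ∀ n, 0 < n → (FreeDivisor.slice B n).Nonempty)
    (X : D) (hXB : (X : FreeDivisor.MU d) ∈ B) (hX1 : (X : FreeDivisor.MU d).1 = 1)
    (g : FreeDivisor.GradedMap d) (hg : FreeDivisor.IsAnalyticFreeMap D g) :
    (∃ f : FreeDivisor.MU d → ℂ, FreeDivisor.IsDeterminantal D f ∧ FreeDivisor.IsC1 D f ∧
        (∀ Y ∈ D, f Y ≠ 0) ∧ FreeDivisor.HasDivisor D f g) ↔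
      ∃ hcl : (1 / (2 * (Real.pi : ℂ) * Complex.I)) • g ∈ FreeDivisor.closedMaps D,
        (Submodule.Quotient.mk ⟨(1 / (2 * (Real.pi : ℂ) * Complex.I)) • g, hcl⟩ :
          FreeDivisor.H1tr D) ∈ FreeDivisor.H1trInt hD.free B X :=
  FreeDivisor.exists_isDeterminantal_iff D B hD hB X hXB hX1 g hg
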